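/- Setting. Let $\mathcal T\subset\mathbb R^d$ be compact and let $\langle\cdot,\cdot\rangle$, $\|\cdot\|$ be the inner product and norm of the real space $L^2(\mathcal T)$. For a real random variable $Y$ and $p\ge1$ write $\|Y\|_p=\mathbb E[|Y|^p]^{1/p}$. Let $m\to\infty$ be a sequence of positive reals. For each $m$ (all objects may depend on $m$) let $\mathcal D$ be a bounded operator on $L^2(\mathcal T)$ with $$\mathcal D=\sum_{j\ge1}\lambda_j\langle e_j,\cdot\rangle e_j,\qquad \lambda_1\ge\lambda_2\ge\dots\ge0,\quad \sum_j\lambda_j<\infty,\quad (e_j)\text{ orthonormal},$$ and let $\widetilde\lambda_j\ge0$ with $\sum_j\widetilde\lambda_j<\infty$ and real random variables $\eta^{\mathcal D}_{i,j},\eta^{\mathcal R}_{i,j}$ be such that $\mathcal D=\sum_{i,j}\sqrt{\widetilde\lambda_i\widetilde\lambda_j}\,\mathbb E[\eta^{\mathcal D}_{i,j}]\langle e_i,\cdot\rangle e_j$. Let $\widehat{\mathcal D}$ be a random bounded operator that is almost surely symmetric and satisfies $$\widehat{\mathcal D}=\sum_{i,j\ge1}\sqrt{\widetilde\lambda_i\widetilde\lambda_j}\,\bigl(\eta^{\mathcal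 D}_{i,j}-\eta^{\mathcal R}_{i,j}\bigr)\langle e_i,\cdot\rangle e_j,\qquad \widehat{\mathcal D}\,\widehat e_j=\widehat\lambda_j\widehat e_j\quad(j\ge1)$$ almost surely, where $(\widehat e_j)$ is orthonormal with $\langle\widehat e_j,e_j\rangle\ge0$ and the eigenvalues are listed from the largest: $\langle\widehat{\mathcal D}v,v\rangle\le\max(\widehat\lambda_j,0)\|v\|^2$ whenever $v\perp\widehat e_1,\dots,\widehat e_{j-1}$ (for positive semidefinite $\widehat{\mathcal D}$ this is the usual non-increasing order). Put $$I_{i,j}=\langle(\widehat{\mathcal D}-\mathcal D)e_i,e_j\rangle,\qquad \Lambda_j=\sum_{k\ne j}\frac{\lambda_j\lambda_k}{(\lambda_j-\lambda_k)^2}.$$ Assumptions. There are constants $C>0$, $a>0$, $h\ge1$, $p\ge1$ and a sequence $s_m\to0$ (independent of the remaining data) and numbers $J_m^+\in\mathbb N$ such that for all $m$, with $q=p\,2^{\lceil h/a\rceil+4}$: (1) $m^{1/2}\sup_{i,j}\|\eta^{\mathcal D}_{i,j}-\mathbb E\eta^{\mathcal D}_{i,j}\|_q\le C$ and $m^{1/2}\sup_{i,j}\|\eta^{\mathcal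 R}_{i,j}\|_q\le s_m$; (2) for $1\le j\le J_m^+$: $\lambda_i\ne\lambda_j$ for all $i\ne j$, $\;m^{-1/2+a}\sum_{i\ne j}\frac{\lambda_i}{|\lambda_j-\lambda_i|}\le C$, $\;m^{-1+2a}\Lambda_j\le C$; and $\lambda_{J_m^+}\ge m^{-h}/C$; (3) $1/C\le\mathbb E[\eta^{\mathcal D}_{j,j}]\le C$ for all $j$, and $\sum_j\lambda_j\le C$. Conclusion. There is a constant $K$, depending only on $C,a,h,p$ and the sequences $m$ and $s_m$, such that for all $m$ and all $1\le J<J_m^+$ $$\Bigl\|\max_{1\le j\le J}\Bigl\|\frac1{\sqrt{\Lambda_j}}\Bigl(\widehat e_j-e_j+\frac{e_j}2\|\widehat e_j-e_j\|^2-\sum_{k\ne j}e_k\frac{I_{k,j}}{\lambda_j-\lambda_k}\Bigr)\Bigr\|\,\Bigr\|_p\le K\,\frac{J^{1/p}m^{-a}}{\sqrt m},$$ $$\Bigl\|\max_{1\le j\le J}\Bigl|\frac1{\Lambda_j}\Bigl(\|\widehat e_j-e_j\|^2-\sum_{k\ne j}\frac{I_{k,j}^2}{(\lambda_j-\lambda_k)^2}\Bigr)\Bigr|\,\Bigr\|_p\le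 K\,\frac{J^{1/p}m^{-a}}{m},$$ where both series over $k$ converge almost surely for every $j\le J$. -/

import Mathlib

open MeasureTheory Filter Topology
open scoped ENNReal

/-- The real Hilbert space `L²(𝒯)`, for `𝒯 ⊆ ℝ^d` with Lebesgue measure. -/
abbrev L2 {d : ℕ} (T : Set (EuclideanSpace ℝ (Fin d))) : Type :=
  Lp ℝ 2 ((volume : Measure (EuclideanSpace ℝ (Fin d))).restrict T)

/-- An operator `𝓓` together with an empirical version `𝓓̂` and its eigen elements (at one
fixed value of the size parameter `m`).  All sequences are indexed from `0`, so index `j`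
here is index `j + 1` in the usual one-based numbering. -/
structure EmpiricalModel (H : Type*) [NormedAddCommGroup H] [InnerProductSpace ℝ H]
    {Ω : Type*} [MeasurableSpace Ω] (P : Measure Ω) where
  /-- eigenvalues `λ_j` of `𝓓` -/
  lam : ℕ → ℝ
  /-- eigenfunctions `e_j` of `𝓓` -/
  e : ℕ → H
  /-- the operator `𝓓` -/
  D : H →L[ℝ] H
  /-- the numbers `λ̃_j` -/
  lamT : ℕ → ℝ
  /-- the contributing random components `η^𝓓_{i,j}` -/
  etaD : ℕ → ℕ → Ω → ℝ
  /-- the negligible random components `η^𝓡_{i,j}` -/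
  etaR : ℕ → ℕ → Ω → ℝ
  /-- the empirical operator `𝓓̂` -/
  Dhat : Ω → H →L[ℝ] H
  /-- the empirical eigenvalues `λ̂_j` -/
  lamHat : ℕ → Ω → ℝ
  /-- the empirical eigenfunctions `ê_j` -/
  eHat : ℕ → Ω → H
  lam_nonneg : ∀ j, 0 ≤ lam j
  lam_antitone : Antitone lam
  lam_summable : Summable lam
  e_orthonormal : Orthonormal ℝ e
  /-- `𝓓 = ∑_j λ_j ⟨e_j, ·⟩ e_j` -/
  D_spectral : ∀ x, HasSum (fun j => (lam j * inner ℝ (e j) x) • e j) (D x)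
  lamT_nonneg : ∀ j, 0 ≤ lamT j
  lamT_summable : Summable lamT
  etaD_measurable : ∀ i j, AEMeasurable (etaD i j) P
  etaR_measurable : ∀ i j, AEMeasurable (etaR i j) P
  /-- `𝓓̂ = ∑_{i,j} √(λ̃_i λ̃_j) (η^𝓓_{i,j} - η^𝓡_{i,j}) ⟨e_i, ·⟩ e_j` -/
  Dhat_expansion : ∀ᵐ ω ∂P, ∀ x,
    HasSum (fun ij : ℕ × ℕ =>
      (Real.sqrt (lamT ij.1 * lamT ij.2) * (etaD ij.1 ij.2 ω - etaR ij.1 ij.2 ω)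
        * inner ℝ (e ij.1) x) • e ij.2) (Dhat ω x)
  /-- `𝓓 = ∑_{i,j} √(λ̃_i λ̃_j) E[η^𝓓_{i,j}] ⟨e_i, ·⟩ e_j` -/
  D_expansion : ∀ x,
    HasSum (fun ij : ℕ × ℕ =>
      (Real.sqrt (lamT ij.1 * lamT ij.2) * (∫ ω, etaD ij.1 ij.2 ω ∂P)
        * inner ℝ (e ij.1) x) • e ij.2) (D x)
  Dhat_symmetric : ∀ᵐ ω ∂P, ∀ x y, inner ℝ (Dhat ω x) y = inner ℝ x (Dhat ω y)
  eHat_measurable : ∀ j, AEStronglyMeasurable (eHat j) P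
  eHat_orthonormal : ∀ᵐ ω ∂P, Orthonormal ℝ (fun j => eHat j ω)
  eHat_eigen : ∀ᵐ ω ∂P, ∀ j, Dhat ω (eHat j ω) = lamHat j ω • eHat j ω
  /-- The empirical eigenvalues are listed from the top: on the orthogonal complement of the
  first eigenfunctions the quadratic form of `𝓓̂` is at most `max(λ̂_j, 0)`.  If `𝓓̂` is
  positive semidefinite this is the usual order `λ̂_0 ≥ λ̂_1 ≥ ⋯`.  The positive part allows
  for an indefinite `𝓓̂` with only finitely many positive eigenvalues, for which these come
  first, in decreasing order, and the order of the others is left free. -/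
  eHat_order : ∀ᵐ ω ∂P, ∀ j, ∀ v : H, (∀ i < j, inner ℝ (eHat i ω) v = 0) →
    inner ℝ (Dhat ω v) v ≤ max (lamHat j ω) 0 * ‖v‖ ^ 2
  /-- the sign of `ê_j` is chosen such that `⟨ê_j, e_j⟩ ≥ 0` -/
  eHat_sign : ∀ᵐ ω ∂P, ∀ j, 0 ≤ inner ℝ (eHat j ω) (e j)

namespace EmpiricalModel

variable {H : Type*} [NormedAddCommGroup H] [InnerProductSpace ℝ H]
  {Ω : Type*} [MeasurableSpace Ω] {P : Measure Ω}

/-- `I_{i,j} = ⟨(𝓓̂ - 𝓓) e_i, e_j⟩`. -/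
noncomputable def I (M : EmpiricalModel H P) (i j : ℕ) (ω : Ω) : ℝ :=
  inner ℝ ((M.Dhat ω - M.D) (M.e i)) (M.e j)

/-- `∑_{i ≠ j} λ_i / |λ_j - λ_i|`. -/
noncomputable def relGapSum (M : EmpiricalModel H P) (j : ℕ) : ℝ :=
  ∑' i, if i = j then 0 else M.lam i / |M.lam j - M.lam i|

/-- `Λ_j = ∑_{k ≠ j} λ_j λ_k / (λ_j - λ_k)²`. -/
noncomputable def Lam (M : EmpiricalModel H P) (j : ℕ) : ℝ :=
  ∑' k, if k = j then 0 else M.lam j * M.lam k / (M.lam j - M.lam k) ^ 2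

/-- The exponent `q = p 2^{⌈h/a⌉ + 4}`. -/
noncomputable def momentExponent (a h p : ℝ) : ℝ := p * 2 ^ (⌈h / a⌉₊ + 4)

/-- The quantitative assumptions at size parameter `m`, with universal constant `C`, bound `s`
for the negligible part, exponents `a, h, p` and range `Jp` (the number `J_m^+`).
The one-based range `1 ≤ j ≤ J_m^+` is `j < Jp`.  As the `λ_i` are summable and
`λ_i ≠ λ_j` for `i ≠ j`, with `λ_j > 0`, the series in `relGapSum_le` and `Lam_le`
converge. -/
structure Assumption (M : EmpiricalModel H P) (C s a h p m : ℝ) (Jp : ℕ) : Prop where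
  etaD_moment : ∀ i j,
    ENNReal.ofReal (Real.sqrt m) *
      eLpNorm (fun ω => M.etaD i j ω - ∫ ω', M.etaD i j ω' ∂P)
        (ENNReal.ofReal (momentExponent a h p)) P ≤ ENNReal.ofReal C
  etaR_moment : ∀ i j,
    ENNReal.ofReal (Real.sqrt m) *
      eLpNorm (M.etaR i j) (ENNReal.ofReal (momentExponent a h p)) P ≤ ENNReal.ofReal s
  lam_ne : ∀ j < Jp, ∀ i, i ≠ j → M.lam i ≠ M.lam j
  relGapSum_le : ∀ j < Jp, m ^ (-(1 / 2 : ℝ) + a) * M.relGapSum j ≤ C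
  Lam_le : ∀ j < Jp, m ^ (-1 + 2 * a) * M.Lam j ≤ C
  /-- `λ_{J_m^+} ≥ m^{-h} / C`; the `λ_j` are non-increasing -/
  lam_lower : ∀ j < Jp, m ^ (-h) / C ≤ M.lam j
  mean_lower : ∀ j, 1 / C ≤ ∫ ω, M.etaD j j ω ∂P
  mean_upper : ∀ j, ∫ ω, M.etaD j j ω ∂P ≤ C
  trace_le : ∑' j, M.lam j ≤ C

/-- The `k`-th term of `∑_{k ≠ j} e_k I_{k,j} / (λ_j - λ_k)`. -/
noncomputable def linTerm (M : EmpiricalModel H P) (j : ℕ) (ω : Ω) (k : ℕ) : H :=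
  if k = j then 0 else (M.I k j ω / (M.lam j - M.lam k)) • M.e k

/-- The `k`-th term of `∑_{k ≠ j} I_{k,j}² / (λ_j - λ_k)²`. -/
noncomputable def sqTerm (M : EmpiricalModel H P) (j : ℕ) (ω : Ω) (k : ℕ) : ℝ :=
  if k = j then 0 else M.I k j ω ^ 2 / (M.lam j - M.lam k) ^ 2

/-- `ê_j - e_j + (e_j / 2) ‖ê_j - e_j‖² - ∑_{k ≠ j} e_k I_{k,j} / (λ_j - λ_k)`. -/
noncomputable def vectorError (M : EmpiricalModel H P) (j : ℕ) (ω : Ω) : H :=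
  M.eHat j ω - M.e j + (‖M.eHat j ω - M.e j‖ ^ 2 / 2) • M.e j - ∑' k, M.linTerm j ω k

/-- `‖ê_j - e_j‖² - ∑_{k ≠ j} I_{k,j}² / (λ_j - λ_k)²`. -/
noncomputable def normError (M : EmpiricalModel H P) (j : ℕ) (ω : Ω) : ℝ :=
  ‖M.eHat j ω - M.e j‖ ^ 2 - ∑' k, M.sqTerm j ω k

end EmpiricalModel

/-! ### Square-summable sequences -/

/-! The perturbation is measured relative to the spectral gaps at one index `j`. Put `w k = |λ_j -
λ_k|` for `k ≠ j` and `w j = g`, a lower bound for `λ_j` and for all gaps at `j`, and let `a i k` be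
the entries of the perturbation. The quantity `T = ∑ a i k ^ 2 / (w i * w k)` is a squared
Hilbert-Schmidt norm that bounds the perturbation as a quadratic form against `∑ w i * v i ^ 2`.

If `T ≤ 1/16`, a min-max argument moves the `j`-th eigenvalue by at most `√T * g` (`eigenvalue_le`,
`le_eigenvalue`). The eigenvector equation, read in coordinates, can then be solved approximately:
Cauchy-Schwarz controls the remainder by squared columns of `a`, and the small factor `T` allows
absorption. This gives the deterministic estimate `eigenvector_expansion`.

All quadratic quantities in that estimate are at most a coefficient times one random variable `U = ∑
γ i * γ k * y i k`, where `y` is `m` times the squared noise and `γ` is a dominating weight of total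
mass 3 (`EntryBound`, `dominatingWeight`). With `z = m ^ (-a)` and `r = Λ_j / m` the coefficients
are of order `z ^ 2` for `T` and `r` for the linear term.

If `T > 1/16`, then `1 ≤ 16 * K * z ^ 2 * U`. A high enough power of this inequality, together with
the polynomial lower bound on `Λ_j`, turns the trivial bound on the errors into the desired order
(`expansion_large`). So no exceptional event has to be discarded: in both cases `expansion_error_le`
bounds the errors by a power of `1 + U`.

Hölder's inequality in the weights `γ` bounds the moment of order `q / 2` of `1 + U`
(`lintegral_noiseSum_le`). Bounding the maximum by a sum of `p`-th powers yields the factor `J ^ (1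
/ p)` (`eLpNorm_iSup_le`). This is carried out for `m ≥ 1`; the general case follows by dividing `m`
by a positive lower bound of the sequence (`rescale`). -/

lemma hasSum_mul_sq_le {ι : Type*} {f g : ι → ℝ} {s : ℝ} (hs : HasSum (fun i => f i * g i) s)
    (hf : Summable fun i => f i ^ 2) (hg : Summable fun i => g i ^ 2) :
    s ^ 2 ≤ (∑' i, f i ^ 2) * ∑' i, g i ^ 2 := by
  have h : Tendsto (fun t : Finset ι => (∑ i ∈ t, f i * g i) ^ 2) atTop (𝓝 (s ^ 2)) := hs.pow 2
  refine le_of_tendsto' h fun t => (Finset.sum_mul_sq_le_sq_mul_sq t f g).trans ?_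
  exact mul_le_mul (hf.sum_le_tsum t fun _ _ => sq_nonneg _)
    (hg.sum_le_tsum t fun _ _ => sq_nonneg _) (Finset.sum_nonneg fun _ _ => sq_nonneg _)
    (tsum_nonneg fun _ => sq_nonneg _)

/-- Cauchy-Schwarz after moving a factor `√w` from one sequence to the other. -/
lemma hasSum_mul_sq_le_weighted {ι : Type*} {a x w : ι → ℝ} {s : ℝ} (hw : ∀ i, 0 < w i)
    (hs : HasSum (fun i => a i * x i) s) (ha : Summable fun i => a i ^ 2 / w i)
    (hx : Summable fun i => w i * x i ^ 2) :
    s ^ 2 ≤ (∑' i, a i ^ 2 / w i) * ∑' i, w i * x i ^ 2 := by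
  have e1 : (fun i => a i ^ 2 / w i) = fun i => (a i / Real.sqrt (w i)) ^ 2 := by
    funext i; rw [div_pow, Real.sq_sqrt (hw i).le]
  have e2 : (fun i => w i * x i ^ 2) = fun i => (Real.sqrt (w i) * x i) ^ 2 := by
    funext i; rw [mul_pow, Real.sq_sqrt (hw i).le]
  have e3 : (fun i => a i * x i) = fun i => (a i / Real.sqrt (w i)) * (Real.sqrt (w i) * x i) := by
    funext i
    have := (Real.sqrt_pos.2 (hw i)).ne'
    field_simp
  rw [e1] at ha ⊢
  rw [e2] at hx ⊢
  rw [e3] at hs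
  exact hasSum_mul_sq_le hs ha hx

lemma summable_mul_of_sq {ι : Type*} {f g : ι → ℝ}
    (hf : Summable fun i => f i ^ 2) (hg : Summable fun i => g i ^ 2) :
    Summable fun i => f i * g i := by
  refine Summable.of_norm_bounded (hf.add hg) fun i => ?_
  rw [Real.norm_eq_abs, abs_mul]
  nlinarith [sq_nonneg (|f i| - |g i|), sq_abs (f i), sq_abs (g i), sq_nonneg (f i),
    sq_nonneg (g i)]

/-! ### Orthonormal systems -/

section Hilbert

variable {H : Type*} [NormedAddCommGroup H] [InnerProductSpace ℝ H]

lemma Orthonormal.inner_eq_of_hasSum {ι : Type*} {e : ι → H} (he : Orthonormal ℝ e)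
    {a : ι → ℝ} {x : H} (hx : HasSum (fun i => a i • e i) x) (k : ι) : inner ℝ (e k) x = a k := by
  classical
  have h1 := hx.mapL (innerSL ℝ (e k))
  have h2 : HasSum (fun i => (innerSL ℝ (e k)) (a i • e i)) (a k) := by
    have := hasSum_single (f := fun i => (innerSL ℝ (e k)) (a i • e i)) k (by
      intro i hi
      simp [he.2 hi.symm])
    simpa [real_inner_smul_right, he.1 k] using this
  simpa using h1.unique h2

lemma Orthonormal.hasSum_sq_of_hasSum {ι : Type*} {e : ι → H} (he : Orthonormal ℝ e)
    {a : ι → ℝ} {x : H} (hx : HasSum (fun i => a i • e i) x) :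
    HasSum (fun i => a i ^ 2) (‖x‖ ^ 2) := by
  have h1 := hx.mapL (innerSL ℝ x)
  simp only [innerSL_apply_apply, real_inner_smul_right, real_inner_self_eq_norm_sq] at h1
  exact h1.congr_fun fun i => by rw [real_inner_comm, he.inner_eq_of_hasSum hx, sq]

lemma Orthonormal.summable_smul_of_sq [CompleteSpace H] {ι : Type*} {e : ι → H}
    (he : Orthonormal ℝ e) {a : ι → ℝ} (ha : Summable fun i => a i ^ 2) :
    Summable fun i => a i • e i := by
  have := (he.orthogonalFamily.summable_iff_norm_sq_summable a).2 (by simpa using ha)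
  simpa using this

lemma Orthonormal.summable_inner_sq {ι : Type*} {e : ι → H} (he : Orthonormal ℝ e) (x : H) :
    Summable fun i => inner ℝ (e i) x ^ 2 := by
  simpa using he.inner_products_summable x

lemma Orthonormal.tsum_inner_sq_le {ι : Type*} {e : ι → H} (he : Orthonormal ℝ e) (x : H) :
    ∑' i, inner ℝ (e i) x ^ 2 ≤ ‖x‖ ^ 2 := by
  simpa using he.tsum_inner_products_le x

lemma Orthonormal.norm_sum_range_sq {f : ℕ → H} (hf : Orthonormal ℝ f) (a : ℕ → ℝ) (n : ℕ) :
    ‖∑ i ∈ Finset.range n, a i • f i‖ ^ 2 = ∑ i ∈ Finset.range n, a i ^ 2 := by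
  rw [← real_inner_self_eq_norm_sq, hf.inner_sum]
  simp [sq]

/-- Among the combinations of `j + 1` orthonormal vectors there is a nonzero one that is
orthogonal to `j` prescribed vectors. -/
lemma Orthonormal.exists_combination_orthogonal {f : ℕ → H} (hf : Orthonormal ℝ f) (g : ℕ → H)
    (j : ℕ) : ∃ a : ℕ → ℝ, 0 < ‖∑ i ∈ Finset.range (j + 1), a i • f i‖ ^ 2 ∧
      ∀ i < j, inner ℝ (g i) (∑ i ∈ Finset.range (j + 1), a i • f i) = 0 := by
  let φ : (Fin (j + 1) → ℝ) →ₗ[ℝ] (Fin j → ℝ) :=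
    LinearMap.pi fun k => ∑ i : Fin (j + 1), inner ℝ (g k) (f i) • LinearMap.proj i
  have hφ : φ.ker ≠ ⊥ := LinearMap.ker_ne_bot_of_finrank_lt (by simp)
  obtain ⟨b, hb, hb0⟩ := (Submodule.ne_bot_iff _).1 hφ
  let a : ℕ → ℝ := fun i => if h : i < j + 1 then b ⟨i, h⟩ else 0
  have ha : ∀ i : Fin (j + 1), a i = b i := fun i => by
    simp only [a, i.2, dite_true]
  refine ⟨a, ?_, fun k hk => ?_⟩
  · rw [hf.norm_sum_range_sq, Finset.sum_range]
    obtain ⟨i, hi⟩ := Function.ne_iff.1 hb0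
    refine Finset.sum_pos' (fun _ _ => sq_nonneg _) ⟨i, Finset.mem_univ _, ?_⟩
    rw [ha]
    exact lt_of_le_of_ne (sq_nonneg _) (pow_ne_zero 2 hi).symm
  · have := congrFun (LinearMap.mem_ker.1 hb) ⟨k, hk⟩
    simp only [φ, LinearMap.pi_apply, LinearMap.sum_apply, LinearMap.smul_apply,
      LinearMap.proj_apply, smul_eq_mul, Pi.zero_apply] at this
    rw [inner_sum, Finset.sum_range, ← this]
    refine Finset.sum_congr rfl fun i _ => ?_
    rw [real_inner_smul_right, ha, mul_comm]

/-! ### Perturbations of a diagonal operator and gap weights -/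

/-- A self-adjoint perturbation `Dh` of the diagonal operator `D`, living on the closed span of
the eigenvectors of `D`. -/
structure DiagonalPerturbation (lam : ℕ → ℝ) (e : ℕ → H) (D Dh : H →L[ℝ] H) : Prop where
  lam_nonneg : ∀ j, 0 ≤ lam j
  lam_antitone : Antitone lam
  e_orthonormal : Orthonormal ℝ e
  D_spectral : ∀ x, HasSum (fun j => (lam j * inner ℝ (e j) x) • e j) (D x)
  Dh_symmetric : ∀ x y, inner ℝ (Dh x) y = inner ℝ x (Dh y)
  Dh_range : ∀ x, HasSum (fun k => inner ℝ (e k) (Dh x) • e k) (Dh x)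

/-- Orthonormal eigenvectors of a symmetric operator, listed from the top. -/
structure RankedEigenvectors (Dh : H →L[ℝ] H) (μ : ℕ → ℝ) (f : ℕ → H) : Prop where
  orthonormal : Orthonormal ℝ f
  eigen : ∀ j, Dh (f j) = μ j • f j
  order : ∀ j, ∀ v : H, (∀ i < j, inner ℝ (f i) v = 0) →
    inner ℝ (Dh v) v ≤ max (μ j) 0 * ‖v‖ ^ 2

/-- The weights `|λ_j - λ_k|`, with `g` in place of zero for `k = j`. -/
noncomputable def relWeight (lam : ℕ → ℝ) (j : ℕ) (g : ℝ) (k : ℕ) : ℝ :=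
  if k = j then g else |lam j - lam k|

/-- `g > 0` is at most the distance of `λ_j` to `0` and to all the other `λ_i`. -/
structure IsGap (lam : ℕ → ℝ) (j : ℕ) (g : ℝ) : Prop where
  pos : 0 < g
  le_lam : g ≤ lam j
  le_dist : ∀ i, i ≠ j → g ≤ |lam j - lam i|

namespace IsGap

variable {lam : ℕ → ℝ} {j : ℕ} {g : ℝ}

lemma le_weight (hg : IsGap lam j g) (k : ℕ) : g ≤ relWeight lam j g k := by
  unfold relWeight
  split_ifs with h
  exacts [le_rfl, hg.le_dist k h]

lemma weight_pos (hg : IsGap lam j g) (k : ℕ) : 0 < relWeight lam j g k :=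
  hg.pos.trans_le (hg.le_weight k)

end IsGap

namespace DiagonalPerturbation

variable {lam : ℕ → ℝ} {e : ℕ → H} {D Dh : H →L[ℝ] H} {j : ℕ} {g : ℝ}

lemma inner_D (hP : DiagonalPerturbation lam e D Dh) (x : H) (k : ℕ) :
    inner ℝ (e k) (D x) = lam k * inner ℝ (e k) x :=
  hP.e_orthonormal.inner_eq_of_hasSum (hP.D_spectral x) k

lemma hasSum_inner_D (hP : DiagonalPerturbation lam e D Dh) (x y : H) :
    HasSum (fun k => lam k * inner ℝ (e k) x * inner ℝ (e k) y) (inner ℝ (D x) y) := by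
  have h := (hP.D_spectral x).mapL (innerSL ℝ y)
  simp only [innerSL_apply_apply, real_inner_smul_right] at h
  rw [real_inner_comm] at h
  simpa only [real_inner_comm y] using h

lemma symm_sub (hP : DiagonalPerturbation lam e D Dh) (x y : H) :
    inner ℝ ((Dh - D) x) y = inner ℝ x ((Dh - D) y) := by
  have h : inner ℝ (D x) y = inner ℝ x (D y) := by
    rw [real_inner_comm (D y)]
    refine (hP.hasSum_inner_D x y).unique ?_
    simpa only [mul_right_comm] using hP.hasSum_inner_D y x
  simp only [_root_.sub_apply, inner_sub_left, inner_sub_right, h, hP.Dh_symmetric]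

lemma hasSum_sub (hP : DiagonalPerturbation lam e D Dh) (x : H) :
    HasSum (fun k => inner ℝ (e k) ((Dh - D) x) • e k) ((Dh - D) x) := by
  have := (hP.Dh_range x).sub (hP.D_spectral x)
  simpa only [_root_.sub_apply, inner_sub_right, hP.inner_D, sub_smul] using this

lemma hasSum_inner_sub (hP : DiagonalPerturbation lam e D Dh) (x y : H) :
    HasSum (fun k => inner ℝ ((Dh - D) x) (e k) * inner ℝ (e k) y) (inner ℝ ((Dh - D) x) y) := by
  have h := (hP.hasSum_sub x).mapL (innerSL ℝ y)
  simp only [innerSL_apply_apply, real_inner_smul_right] at h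
  rw [real_inner_comm] at h
  exact h.congr_fun fun k => by rw [real_inner_comm (e k) y, real_inner_comm]

lemma hasSum_entry (hP : DiagonalPerturbation lam e D Dh) (v : H) (k : ℕ) :
    HasSum (fun i => inner ℝ ((Dh - D) (e i)) (e k) * inner ℝ (e i) v)
      (inner ℝ ((Dh - D) v) (e k)) := by
  rw [hP.symm_sub v, real_inner_comm]
  have := hP.hasSum_inner_sub (e k) v
  exact this.congr_fun fun i => by rw [hP.symm_sub (e i), real_inner_comm (e i)]

/-- Bounded weights make the weighted norm `∑ w i * v i ^ 2` finite for every vector, so that it can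
later be absorbed. -/
lemma weight_le (hP : DiagonalPerturbation lam e D Dh) (hg : IsGap lam j g) (k : ℕ) :
    relWeight lam j g k ≤ lam 0 := by
  have h0 := hP.lam_antitone (Nat.zero_le j)
  have h1 := hP.lam_antitone (Nat.zero_le k)
  have h2 := hP.lam_nonneg j
  have h3 := hP.lam_nonneg k
  have := hg.le_lam
  unfold relWeight
  split_ifs
  · linarith
  · rw [abs_le]; constructor <;> linarith

lemma summable_weight (hP : DiagonalPerturbation lam e D Dh) (hg : IsGap lam j g) (v : H) :
    Summable fun i => relWeight lam j g i * inner ℝ (e i) v ^ 2 :=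
  Summable.of_nonneg_of_le (fun i => mul_nonneg (hg.weight_pos i).le (sq_nonneg _))
    (fun i => mul_le_mul_of_nonneg_right (hP.weight_le hg i) (sq_nonneg _))
    ((hP.e_orthonormal.summable_inner_sq v).mul_left _)

end DiagonalPerturbation

end Hilbert

/-! ### Relative Hilbert-Schmidt bound and location of the eigenvalue -/

section Hilbert

variable {H : Type*} [NormedAddCommGroup H] [InnerProductSpace ℝ H]

/-- The matrix entry `⟨A e_i, e_k⟩`. -/
noncomputable def matrixEntry (A : H →L[ℝ] H) (e : ℕ → H) (i k : ℕ) : ℝ :=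
  inner ℝ (A (e i)) (e k)

/-- The square of the `k`-th column of a matrix, with weights `1 / w_i`. -/
noncomputable def columnSq (a : ℕ → ℕ → ℝ) (w : ℕ → ℝ) (k : ℕ) : ℝ :=
  ∑' i, a i k ^ 2 / w i

/-- The terms of the squared Hilbert-Schmidt norm of `w^{-1/2} a w^{-1/2}`. -/
noncomputable def relHSTerm (a : ℕ → ℕ → ℝ) (w : ℕ → ℝ) (q : ℕ × ℕ) : ℝ :=
  a q.2 q.1 ^ 2 / w q.2 / w q.1

section Columns

variable {a : ℕ → ℕ → ℝ} {w : ℕ → ℝ}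

lemma columnSq_nonneg (hw : ∀ i, 0 < w i) (k : ℕ) : 0 ≤ columnSq a w k :=
  tsum_nonneg fun i => div_nonneg (sq_nonneg _) (hw i).le

lemma summable_column (hw : ∀ i, 0 < w i) (hT : Summable (relHSTerm a w)) (k : ℕ) :
    Summable fun i => a i k ^ 2 / w i := by
  refine ((hT.prod_factor k).mul_right (w k)).congr fun i => ?_
  simp only [relHSTerm]
  rw [div_mul_cancel₀ _ (hw k).ne']

lemma summable_columnSq_div (hT : Summable (relHSTerm a w)) :
    Summable fun k => columnSq a w k / w k := by
  refine hT.prod.congr fun k => ?_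
  simp only [relHSTerm, columnSq, tsum_div_const]

lemma tsum_columnSq_div (hT : Summable (relHSTerm a w)) :
    ∑' k, columnSq a w k / w k = ∑' q, relHSTerm a w q := by
  rw [hT.tsum_prod]
  simp only [relHSTerm, columnSq, tsum_div_const]

end Columns

namespace DiagonalPerturbation

variable {lam : ℕ → ℝ} {e : ℕ → H} {D Dh : H →L[ℝ] H} {j : ℕ} {g : ℝ}

/-- Weighted Cauchy-Schwarz for the expansion of `v` in the `e i`. The part of `v` outside their
closed span does not matter, because the perturbation is symmetric and has its range in that span.
-/
lemma sq_inner_sub_le (hP : DiagonalPerturbation lam e D Dh) (hg : IsGap lam j g)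
    (hT : Summable (relHSTerm (matrixEntry (Dh - D) e) (relWeight lam j g))) (v : H) (k : ℕ) :
    inner ℝ ((Dh - D) v) (e k) ^ 2 ≤
      columnSq (matrixEntry (Dh - D) e) (relWeight lam j g) k *
        ∑' i, relWeight lam j g i * inner ℝ (e i) v ^ 2 :=
  hasSum_mul_sq_le_weighted hg.weight_pos (hP.hasSum_entry v k)
    (summable_column hg.weight_pos hT k) (hP.summable_weight hg v)

/-- The relative form bound of the perturbation. -/
lemma abs_inner_sub_le (hP : DiagonalPerturbation lam e D Dh) (hg : IsGap lam j g)
    (hT : Summable (relHSTerm (matrixEntry (Dh - D) e) (relWeight lam j g))) {t : ℝ}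
    (ht : 0 ≤ t)
    (hTt : ∑' q, relHSTerm (matrixEntry (Dh - D) e) (relWeight lam j g) q ≤ t ^ 2) (v : H) :
    |inner ℝ ((Dh - D) v) v| ≤ t * ∑' i, relWeight lam j g i * inner ℝ (e i) v ^ 2 := by
  set w := relWeight lam j g
  set W := ∑' i, w i * inner ℝ (e i) v ^ 2
  have hw := hg.weight_pos
  have hW : 0 ≤ W := tsum_nonneg fun i => mul_nonneg (hw i).le (sq_nonneg _)
  have hs := summable_columnSq_div hT
  have hb : ∀ k, inner ℝ ((Dh - D) v) (e k) ^ 2 / w k ≤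
      columnSq (matrixEntry (Dh - D) e) w k / w k * W := fun k => by
    rw [div_mul_eq_mul_div]
    exact div_le_div_of_nonneg_right (hP.sq_inner_sub_le hg hT v k) (hw k).le
  have hsum : Summable fun k => inner ℝ ((Dh - D) v) (e k) ^ 2 / w k :=
    Summable.of_nonneg_of_le (fun k => div_nonneg (sq_nonneg _) (hw k).le) hb (hs.mul_right W)
  have h1 := hasSum_mul_sq_le_weighted hw (hP.hasSum_inner_sub v v) hsum
    (hP.summable_weight hg v)
  have h2 : ∑' k, inner ℝ ((Dh - D) v) (e k) ^ 2 / w k ≤ t ^ 2 * W := by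
    refine (hsum.tsum_le_tsum hb (hs.mul_right W)).trans ?_
    rw [tsum_mul_right, tsum_columnSq_div hT]
    exact mul_le_mul_of_nonneg_right hTt hW
  refine abs_le_of_sq_le_sq ?_ (mul_nonneg ht hW)
  calc _ ≤ _ := h1
    _ ≤ t ^ 2 * W * W := mul_le_mul_of_nonneg_right h2 hW
    _ = (t * W) ^ 2 := by ring

/-- Min-max: test the form on a combination of `f 0, …, f j` that is orthogonal to `e 0, …, e (j -
1)`. On such a vector only the `λ_k` with `k ≥ j` enter. -/
lemma eigenvalue_le (hP : DiagonalPerturbation lam e D Dh) (hg : IsGap lam j g)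
    (hT : Summable (relHSTerm (matrixEntry (Dh - D) e) (relWeight lam j g))) {t : ℝ}
    (ht : 0 ≤ t) (ht1 : t ≤ 1)
    (hTt : ∑' q, relHSTerm (matrixEntry (Dh - D) e) (relWeight lam j g) q ≤ t ^ 2)
    {μ : ℕ → ℝ} {f : ℕ → H} (hf : RankedEigenvectors Dh μ f) : μ j ≤ lam j + t * g := by
  rcases le_or_gt (μ j) 0 with h0 | h0
  · linarith [hP.lam_nonneg j, mul_nonneg ht hg.pos.le]
  obtain ⟨b, hb, hbo⟩ := hf.orthonormal.exists_combination_orthogonal e j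
  set v := ∑ i ∈ Finset.range (j + 1), b i • f i
  have hmono : ∀ i < j + 1, μ j ≤ μ i := fun i hi => by
    rcases (Nat.lt_succ_iff_lt_or_eq.1 hi) with hi | rfl
    -- The ordering condition at `i`, tested on the later eigenvector `f j`; since `μ j > 0`, the
    -- positive part is harmless.
    · have := hf.order i (f j) fun l hl => hf.orthonormal.2 (hl.trans hi).ne
      rw [hf.eigen, real_inner_smul_left, real_inner_self_eq_norm_sq, hf.orthonormal.1 j] at this
      rcases le_max_iff.1 (show μ j ≤ max (μ i) 0 by linarith) with h | h
      · exact h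
      · linarith
    · exact le_rfl
  have hlow : μ j * ‖v‖ ^ 2 ≤ inner ℝ (Dh v) v := by
    have h1 : Dh v = ∑ i ∈ Finset.range (j + 1), (μ i * b i) • f i := by
      simp only [v, map_sum, map_smul, hf.eigen, smul_smul, mul_comm (b _)]
    rw [h1, hf.orthonormal.inner_sum, hf.orthonormal.norm_sum_range_sq, Finset.mul_sum]
    refine Finset.sum_le_sum fun i hi => ?_
    have := hmono i (Finset.mem_range.1 hi)
    simp only [conj_trivial]
    nlinarith [sq_nonneg (b i)]
  have hDv := hP.hasSum_inner_D v v
  have hW := (hP.summable_weight hg v).hasSum.mul_left t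
  have hup : inner ℝ (Dh v) v ≤ (lam j + t * g) * ‖v‖ ^ 2 := by
    have h1 : inner ℝ (Dh v) v = inner ℝ (D v) v + inner ℝ ((Dh - D) v) v := by
      rw [_root_.sub_apply, inner_sub_left]; ring
    have h2 := le_of_abs_le (hP.abs_inner_sub_le hg hT ht hTt v)
    have h3 := hasSum_le (fun k => ?_) (hDv.add hW)
      ((hP.e_orthonormal.summable_inner_sq v).hasSum.mul_left (lam j + t * g))
    · have h4 := mul_le_mul_of_nonneg_left (hP.e_orthonormal.tsum_inner_sq_le v)
        (add_nonneg (hP.lam_nonneg j) (mul_nonneg ht hg.pos.le))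
      linarith
    · rw [mul_assoc, ← sq, ← mul_assoc, ← add_mul]
      rcases lt_or_ge k j with hk | hk
      · simp [hbo k hk]
      · refine mul_le_mul_of_nonneg_right ?_ (sq_nonneg _)
        unfold relWeight
        split_ifs with hkj
        · rw [hkj]
        -- Since `t ≤ 1`, `λ_k + t * (λ_j - λ_k) ≤ λ_j`: the relative perturbation cannot push a
        -- lower level above `λ_j`.
        · have := hP.lam_antitone hk
          rw [abs_of_nonneg (by linarith)]
          nlinarith [mul_nonneg ht hg.pos.le]
  exact le_of_mul_le_mul_right (hlow.trans hup) hb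

/-- The dual choice: a combination of `e 0, …, e j` orthogonal to `f 0, …, f (j - 1)`, to which the
ordering condition applies directly. Parseval is needed in place of Bessel and holds since the
combination is finite. -/
lemma le_eigenvalue (hP : DiagonalPerturbation lam e D Dh) (hg : IsGap lam j g)
    (hT : Summable (relHSTerm (matrixEntry (Dh - D) e) (relWeight lam j g))) {t : ℝ}
    (ht : 0 ≤ t) (ht1 : t < 1)
    (hTt : ∑' q, relHSTerm (matrixEntry (Dh - D) e) (relWeight lam j g) q ≤ t ^ 2)
    {μ : ℕ → ℝ} {f : ℕ → H} (hf : RankedEigenvectors Dh μ f) : lam j - t * g ≤ μ j := by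
  obtain ⟨b, hb, hbo⟩ := hP.e_orthonormal.exists_combination_orthogonal f j
  set v := ∑ i ∈ Finset.range (j + 1), b i • e i with hv
  have hcoef : ∀ k, j < k → inner ℝ (e k) v = 0 := fun k hk => by
    rw [hv, inner_sum]
    refine Finset.sum_eq_zero fun i hi => ?_
    have : i ≠ k := by have := Finset.mem_range.1 hi; omega
    rw [real_inner_smul_right, hP.e_orthonormal.2 this.symm, mul_zero]
  have hcoef' : ∀ k ∈ Finset.range (j + 1), inner ℝ (e k) v = b k := fun k hk =>
    hP.e_orthonormal.inner_right_sum b hk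
  have hns : HasSum (fun k => inner ℝ (e k) v ^ 2) (‖v‖ ^ 2) := by
    have h1 : ∑ k ∈ Finset.range (j + 1), b k ^ 2 =
        ∑ k ∈ Finset.range (j + 1), inner ℝ (e k) v ^ 2 :=
      Finset.sum_congr rfl fun k hk => by rw [hcoef' k hk]
    rw [hP.e_orthonormal.norm_sum_range_sq, h1]
    refine hasSum_sum_of_ne_finset_zero fun k hk => ?_
    rw [hcoef k (by simpa using hk)]; ring
  have hDv := hP.hasSum_inner_D v v
  have hW := (hP.summable_weight hg v).hasSum.mul_left t
  have hlow : (lam j - t * g) * ‖v‖ ^ 2 ≤ inner ℝ (Dh v) v := by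
    have h1 : inner ℝ (Dh v) v = inner ℝ (D v) v + inner ℝ ((Dh - D) v) v := by
      rw [_root_.sub_apply, inner_sub_left]; ring
    have h2 := neg_le_of_abs_le (hP.abs_inner_sub_le hg hT ht hTt v)
    have h3 := hasSum_le (fun k => ?_) (hns.mul_left (lam j - t * g)) (hDv.sub hW)
    · linarith
    · rw [mul_assoc (lam k), ← sq, ← mul_assoc, ← sub_mul]
      rcases lt_or_ge j k with hk | hk
      · simp [hcoef k hk]
      · refine mul_le_mul_of_nonneg_right ?_ (sq_nonneg _)
        unfold relWeight
        split_ifs with hkj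
        · rw [hkj]
        · have := hP.lam_antitone hk
          rw [abs_of_nonpos (by linarith)]
          nlinarith [mul_nonneg ht hg.pos.le]
  have h := le_of_mul_le_mul_right (hlow.trans (hf.order j v hbo)) hb
  -- The alternative `λ_j - t * g ≤ 0` is impossible because `g ≤ λ_j` and `t < 1`.
  rcases le_max_iff.1 h with h | h
  · exact h
  · nlinarith [hg.pos, hg.le_lam]

end DiagonalPerturbation

end Hilbert

/-! ### Deterministic expansion of an eigenvector -/

section Hilbert

variable {H : Type*} [NormedAddCommGroup H] [InnerProductSpace ℝ H]

/-- The coefficients of the first order term of the eigenvector expansion. -/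
noncomputable def linCoeff (a : ℕ → ℕ → ℝ) (lam : ℕ → ℝ) (j k : ℕ) : ℝ :=
  if k = j then 0 else a k j / (lam j - lam k)

/-- `∑_{k ≠ j} r_k / w_k²` for the squared columns `r_k` of a matrix. -/
noncomputable def resolventColumnSq (a : ℕ → ℕ → ℝ) (w : ℕ → ℝ) (j : ℕ) : ℝ :=
  ∑' k, if k = j then 0 else columnSq a w k / w k / w k

namespace IsGap

variable {lam : ℕ → ℝ} {j : ℕ} {g : ℝ} {a : ℕ → ℕ → ℝ}

lemma weight_sq (_hg : IsGap lam j g) {k : ℕ} (hk : k ≠ j) :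
    relWeight lam j g k ^ 2 = (lam j - lam k) ^ 2 := by
  simp [relWeight, hk]

lemma summable_linCoeff (hg : IsGap lam j g) (hT : Summable (relHSTerm a (relWeight lam j g))) :
    Summable fun k => linCoeff a lam j k ^ 2 := by
  refine Summable.of_nonneg_of_le (fun _ => sq_nonneg _) (fun k => ?_)
    ((summable_column hg.weight_pos hT j).mul_right (1 / g))
  have hw := hg.weight_pos k
  unfold linCoeff
  split_ifs with hk
  · rw [zero_pow two_ne_zero]
    exact mul_nonneg (div_nonneg (sq_nonneg _) hw.le) (one_div_nonneg.2 hg.pos.le)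
  · rw [div_pow, ← hg.weight_sq hk, sq (relWeight lam j g k), ← div_div,
      div_eq_mul_one_div _ (relWeight lam j g k)]
    exact mul_le_mul_of_nonneg_left (one_div_le_one_div_of_le hg.pos (hg.le_weight k))
      (div_nonneg (sq_nonneg _) hw.le)

lemma summable_resolventColumn (hg : IsGap lam j g)
    (hT : Summable (relHSTerm a (relWeight lam j g))) :
    Summable fun k => if k = j then 0 else
      columnSq a (relWeight lam j g) k / relWeight lam j g k / relWeight lam j g k := by
  have h0 : ∀ k, 0 ≤ columnSq a (relWeight lam j g) k / relWeight lam j g k := fun k =>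
    div_nonneg (columnSq_nonneg hg.weight_pos k) (hg.weight_pos k).le
  refine Summable.of_nonneg_of_le (fun k => ?_) (fun k => ?_)
    ((summable_columnSq_div hT).mul_right (1 / g))
  · split_ifs
    exacts [le_rfl, div_nonneg (h0 k) (hg.weight_pos k).le]
  · split_ifs
    · exact mul_nonneg (h0 k) (one_div_nonneg.2 hg.pos.le)
    · rw [div_eq_mul_one_div _ (relWeight lam j g k)]
      exact mul_le_mul_of_nonneg_left (one_div_le_one_div_of_le hg.pos (hg.le_weight k)) (h0 k)

end IsGap

lemma sq_add_sub_le (a b c : ℝ) : (a + b - c) ^ 2 ≤ 3 * (a ^ 2 + b ^ 2 + c ^ 2) := by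
  nlinarith [sq_nonneg (a - b), sq_nonneg (a + c), sq_nonneg (b + c)]

lemma weighted_sum_div {w : ℝ} (hw : 0 < w) (A R W s X : ℝ) :
    3 * (A + R * W + s * w ^ 2 * X) / w = 3 * (A / w + R / w * W + s * (w * X)) := by
  field_simp

lemma weighted_sum_div_sq {w : ℝ} (hw : 0 < w) (d Y R W s X : ℝ) :
    3 * (d * (Y * w ^ 2) + R * W + s * w ^ 2 * X) / w ^ 2 =
      3 * (d * Y + R / w / w * W + s * X) := by
  field_simp

namespace DiagonalPerturbation

variable {lam : ℕ → ℝ} {e : ℕ → H} {D Dh : H →L[ℝ] H} {j : ℕ} {g : ℝ}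

lemma matrixEntry_symm (hP : DiagonalPerturbation lam e D Dh) (i k : ℕ) :
    matrixEntry (Dh - D) e i k = matrixEntry (Dh - D) e k i := by
  unfold matrixEntry
  rw [hP.symm_sub, real_inner_comm]

/-- The eigenvector equation in coordinates. -/
lemma eigen_coordinate (hP : DiagonalPerturbation lam e D Dh) {u : H} {μ : ℝ}
    (hu : Dh u = μ • u) (k : ℕ) :
    (lam j - lam k) * inner ℝ (e k) u =
      inner ℝ (e j) u * matrixEntry (Dh - D) e k j +
        inner ℝ ((Dh - D) (u - inner ℝ (e j) u • e j)) (e k) -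
        (μ - lam j) * inner ℝ (e k) u := by
  have h1 : inner ℝ ((Dh - D) u) (e k) = (μ - lam k) * inner ℝ (e k) u := by
    rw [_root_.sub_apply, hu, inner_sub_left, real_inner_smul_left, real_inner_comm,
      real_inner_comm _ (D u), hP.inner_D]
    ring
  rw [map_sub, map_smul, inner_sub_left, real_inner_smul_left, h1, hP.matrixEntry_symm]
  unfold matrixEntry
  ring

/-- The system `e` need not be complete, but an eigenvector with nonzero eigenvalue lies in the
range of `Dh`, hence in the closed span of `e`. -/
lemma hasSum_eigenvector (hP : DiagonalPerturbation lam e D Dh) {u : H} {μ : ℝ}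
    (hu : Dh u = μ • u) (hμ : μ ≠ 0) : HasSum (fun k => inner ℝ (e k) u • e k) u := by
  have := (hP.Dh_range u).const_smul μ⁻¹
  simpa only [hu, real_inner_smul_right, smul_smul, inv_mul_cancel_left₀ hμ,
    inv_mul_cancel₀ hμ, one_smul, mul_assoc] using this

set_option maxHeartbeats 1000000 in
/-- Deterministic expansion of an eigenvector under a relatively small perturbation. -/
theorem eigenvector_expansion [CompleteSpace H] (hP : DiagonalPerturbation lam e D Dh)
    (hg : IsGap lam j g)
    (hT : Summable (relHSTerm (matrixEntry (Dh - D) e) (relWeight lam j g))) {t : ℝ}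
    (ht : 0 ≤ t) (ht1 : t ≤ 1 / 4)
    (hTt : ∑' q, relHSTerm (matrixEntry (Dh - D) e) (relWeight lam j g) q ≤ t ^ 2)
    {μ : ℕ → ℝ} {f : ℕ → H} (hf : RankedEigenvectors Dh μ f)
    (hsign : 0 ≤ inner ℝ (f j) (e j)) {L A B N : ℝ} {V : H}
    (hL : L = ∑' k, linCoeff (matrixEntry (Dh - D) e) lam j k ^ 2)
    (hA : A = resolventColumnSq (matrixEntry (Dh - D) e) (relWeight lam j g) j)
    (hB : B = columnSq (matrixEntry (Dh - D) e) (relWeight lam j g) j)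
    (hV : V = f j - e j + (‖f j - e j‖ ^ 2 / 2) • e j -
      ∑' k, linCoeff (matrixEntry (Dh - D) e) lam j k • e k)
    (hN : N = ‖f j - e j‖ ^ 2 - L) :
    ∃ q : ℝ, 0 ≤ q ∧ q ≤ 1 ∧ q ≤ 4 * (L + 5 * (A * B)) ∧
      ‖V‖ ^ 2 ≤ 3 * (q ^ 2 * L + 5 * (A * B) + t ^ 2 * q) ∧
      |N| ≤ ‖V‖ ^ 2 + 2 * (‖V‖ * Real.sqrt L) + q ^ 2 := by
  set a := matrixEntry (Dh - D) e with ha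
  set w := relWeight lam j g with hwdef
  have hw := hg.weight_pos
  have ht2 : t ^ 2 ≤ 1 / 16 := by nlinarith
  set u := f j with hu
  have hunorm : ‖u‖ = 1 := hf.orthonormal.1 j
  have hejnorm : ‖e j‖ = 1 := hP.e_orthonormal.1 j
  set c : ℝ := inner ℝ (e j) u with hc
  have hc0 : 0 ≤ c := by rwa [real_inner_comm] at hsign
  have hc1 : c ≤ 1 := by
    have := real_inner_le_norm (e j) u
    rwa [hunorm, hejnorm, mul_one] at this
  set x : ℕ → ℝ := fun k => inner ℝ (e k) (u - c • e j) with hx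
  have hxj : x j = 0 := by
    simp only [hx, inner_sub_right, real_inner_smul_right, real_inner_self_eq_norm_sq, hejnorm]
    simp [hc]
  have hxk : ∀ k, k ≠ j → x k = inner ℝ (e k) u := fun k hk => by
    simp only [hx, inner_sub_right, real_inner_smul_right, hP.e_orthonormal.2 hk]
    ring
  set l : ℕ → ℝ := linCoeff a lam j with hl
  have hlj : l j = 0 := by simp [hl, linCoeff]
  have hlk : ∀ k, k ≠ j → l k * (lam j - lam k) = a k j := fun k hk => by
    have h0 : lam j - lam k ≠ 0 := by
      have := hg.le_dist k hk
      exact abs_pos.1 (hg.pos.trans_le this)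
    simp only [hl, linCoeff, if_neg hk]
    field_simp
  set ρ : ℕ → ℝ := fun k => if k = j then 0 else columnSq a w k / w k / w k with hρ
  have hρ0 : ∀ k, 0 ≤ ρ k := fun k => by
    simp only [hρ]
    split_ifs
    exacts [le_rfl, div_nonneg (div_nonneg (columnSq_nonneg hw k) (hw k).le) (hw k).le]
  have hρk : ∀ k, k ≠ j → ρ k = columnSq a w k / w k / w k := fun k hk => if_neg hk
  have hak : ∀ k, k ≠ j → a k j ^ 2 = l k ^ 2 * w k ^ 2 := fun k hk => by
    rw [← hlk k hk, mul_pow, hwdef, hg.weight_sq hk]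
  have hρs : Summable ρ := hg.summable_resolventColumn hT
  have hls : Summable fun k => l k ^ 2 := hg.summable_linCoeff hT
  -- the eigenvalue
  have hμ1 := hP.eigenvalue_le hg hT ht (by linarith) hTt hf
  have hμ2 := hP.le_eigenvalue hg hT ht (by linarith) hTt hf
  have hμ : (μ j - lam j) ^ 2 ≤ t ^ 2 * g ^ 2 := by
    rw [← mul_pow]
    exact sq_le_sq' (by linarith) (by linarith)
  -- The shift is at most `g / 4 ≤ λ_j / 4`, so the eigenvalue stays positive and `u` expands in the
  -- `e k`.
  have hμpos : μ j ≠ 0 := by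
    have h1 := hg.pos
    have h2 := hg.le_lam
    have h3 := mul_le_mul_of_nonneg_right ht1 h1.le
    exact (show 0 < μ j by linarith).ne'
  -- coordinates
  have hcoord : ∀ k, k ≠ j → (lam j - lam k) * x k =
      c * a k j + inner ℝ ((Dh - D) (u - c • e j)) (e k) - (μ j - lam j) * x k := fun k hk => by
    rw [hxk k hk]
    exact hP.eigen_coordinate (hf.eigen j) k
  have hus : HasSum (fun k => inner ℝ (e k) u • e k) u := hP.hasSum_eigenvector (hf.eigen j) hμpos
  have husx : HasSum (fun k => x k • e k) (u - c • e j) := by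
    have h1 := hus.sub (hasSum_ite_eq j (c • e j))
    refine h1.congr_fun fun k => ?_
    by_cases hk : k = j
    · subst hk; simp [hxj, hc]
    · simp [hk, hxk k hk]
  have hxs0 := hP.e_orthonormal.hasSum_sq_of_hasSum husx
  have hnorm : ‖u - c • e j‖ ^ 2 = 1 - c ^ 2 := by
    rw [norm_sub_sq_real, real_inner_smul_right, real_inner_comm, ← hc, norm_smul, hunorm,
      hejnorm, Real.norm_eq_abs, mul_one, sq_abs]
    ring
  have hxs : HasSum (fun k => x k ^ 2) (1 - c ^ 2) := hnorm ▸ hxs0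
  have hcc : c ^ 2 ≤ c := by
    rw [sq]
    exact mul_le_of_le_one_left hc0 hc1
  set q : ℝ := 1 - c ^ 2 with hq
  have hq0 : 0 ≤ q := by linarith
  have hq1 : q ≤ 1 := by linarith [sq_nonneg c]
  have hcq : (1 - c) ^ 2 ≤ q ^ 2 := by
    have : 1 - c ≤ q := by linarith
    exact pow_le_pow_left₀ (by linarith) this 2
  set W : ℝ := ∑' i, w i * x i ^ 2 with hW
  have hWs : Summable fun i => w i * x i ^ 2 := hP.summable_weight hg _
  have hW0 : 0 ≤ W := tsum_nonneg fun i => mul_nonneg (hw i).le (sq_nonneg _)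
  have hs : ∀ k, inner ℝ ((Dh - D) (u - c • e j)) (e k) ^ 2 ≤ columnSq a w k * W := fun k =>
    hP.sq_inner_sub_le hg hT _ k
  have hε : ∀ k, ((μ j - lam j) * x k) ^ 2 ≤ t ^ 2 * w k ^ 2 * x k ^ 2 := fun k => by
    rw [mul_pow]
    refine mul_le_mul_of_nonneg_right (hμ.trans ?_) (sq_nonneg _)
    exact mul_le_mul_of_nonneg_left (pow_le_pow_left₀ hg.pos.le (hg.le_weight k) 2) (sq_nonneg _)
  have hmain : ∀ k, k ≠ j → w k ^ 2 * x k ^ 2 ≤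
      3 * (a k j ^ 2 + columnSq a w k * W + t ^ 2 * w k ^ 2 * x k ^ 2) := fun k hk => by
    rw [hg.weight_sq hk, ← mul_pow, hcoord k hk]
    refine (sq_add_sub_le _ _ _).trans ?_
    have h1 : (c * a k j) ^ 2 ≤ a k j ^ 2 := by
      rw [mul_pow]
      exact mul_le_of_le_one_left (sq_nonneg _) (by linarith)
    have := hs k
    have := hε k
    rw [hg.weight_sq hk] at this
    linarith
  -- the weighted norm
  have hB0 : 0 ≤ B := hB ▸ columnSq_nonneg hw j
  have hA0 : 0 ≤ A := hA ▸ tsum_nonneg hρ0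
  have hL0 : 0 ≤ L := hL ▸ tsum_nonneg fun _ => sq_nonneg _
  have hWB : W ≤ 5 * B := by
    -- Divide `hmain` by `w k` and sum; the index `j`, where `hmain` is not available, contributes
    -- nothing as `x j = 0`.
    have h1 : W ≤ 3 * (B + t ^ 2 * W + t ^ 2 * W) := by
      have hr := (summable_columnSq_div hT)
      have h2 := hasSum_le (fun k => ?_) hWs.hasSum
        ((((summable_column hw hT j).hasSum.add (hr.hasSum.mul_right W)).add
          (hWs.hasSum.mul_left (t ^ 2))).mul_left 3)
      · rw [tsum_columnSq_div hT] at h2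
        refine h2.trans ?_
        have := mul_le_mul_of_nonneg_right hTt hW0
        rw [hB]
        unfold columnSq
        linarith
      · have hwk : 0 < w k := hw k
        have hr0 : 0 ≤ columnSq a w k / w k := div_nonneg (columnSq_nonneg hw k) hwk.le
        have hi0 : 0 ≤ a k j ^ 2 / w k := div_nonneg (sq_nonneg _) hwk.le
        by_cases hk : k = j
        · rw [hk] at hr0 hi0 hwk ⊢
          simp only [hxj]
          have := mul_nonneg hr0 hW0
          norm_num
          linarith
        · have h3 := div_le_div_of_nonneg_right (hmain k hk) hwk.le
          rw [weighted_sum_div hwk, sq (w k), mul_assoc, mul_div_cancel_left₀ _ hwk.ne'] at h3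
          exact h3
    -- Absorption: `6 * t ^ 2 ≤ 3 / 8`, so `W ≤ (24 / 5) * B`.
    linarith [mul_le_mul_of_nonneg_right ht2 hW0]
  -- the part orthogonal to `e j`
  have hAW : A * W ≤ 5 * (A * B) := by linarith [mul_le_mul_of_nonneg_left hWB hA0]
  -- Now divide by `w k ^ 2`. Absorbing `3 * t ^ 2 * q ≤ (3 / 16) * q` leaves the factor `48 / 13 <
  -- 4`.
  have hqle : q ≤ 4 * (L + 5 * (A * B)) := by
    have h2 := hasSum_le (fun k => ?_) hxs
      (((hls.hasSum.add (hρs.hasSum.mul_right W)).add (hxs.mul_left (t ^ 2))).mul_left 3)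
    · rw [← hL, show ∑' k, ρ k = A from hA.symm] at h2
      linarith [mul_le_mul_of_nonneg_right ht2 hq0]
    · by_cases hk : k = j
      · subst hk
        simp [hxj, hlj, hρ]
      · have hwk : 0 < w k := hw k
        have h3 := div_le_div_of_nonneg_right (hmain k hk) (pow_pos hwk 2).le
        rw [hak k hk, ← one_mul (l k ^ 2 * w k ^ 2), weighted_sum_div_sq hwk, one_mul,
          mul_div_cancel_left₀ _ (pow_pos hwk 2).ne', ← hρk k hk] at h3
        exact h3
  -- the error
  have hVs : HasSum (fun k => (x k - l k) • e k) V := by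
    have h1 := husx.sub (hP.e_orthonormal.summable_smul_of_sq hls).hasSum
    -- Since `‖u - e j‖ ^ 2 = 2 - 2 * c`, the correction in `V` replaces `e j` by the projection `c
    -- • e j`.
    have h2 : V = u - c • e j - ∑' k, l k • e k := by
      have h3 : ‖u - e j‖ ^ 2 = 2 - 2 * c := by
        rw [norm_sub_sq_real, real_inner_comm, ← hc, hunorm, hejnorm]; ring
      rw [hV, h3]
      module
    rw [h2]
    simpa only [sub_smul] using h1
  have hVn := hP.e_orthonormal.hasSum_sq_of_hasSum hVs
  have hVle : ‖V‖ ^ 2 ≤ 3 * (q ^ 2 * L + 5 * (A * B) + t ^ 2 * q) := by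
    have h2 := hasSum_le (fun k => ?_) hVn
      ((((hls.hasSum.mul_left ((1 - c) ^ 2)).add (hρs.hasSum.mul_right W)).add
        (hxs.mul_left (t ^ 2))).mul_left 3)
    · rw [← hL, show ∑' k, ρ k = A from hA.symm] at h2
      have := mul_le_mul_of_nonneg_right hcq hL0
      linarith
    · by_cases hk : k = j
      · subst hk
        simp [hxj, hlj, hρ]
      · have hwk : 0 < w k := hw k
        have h4 : w k ^ 2 * (x k - l k) ^ 2 ≤ 3 * ((1 - c) ^ 2 * a k j ^ 2 +
            columnSq a w k * W + t ^ 2 * w k ^ 2 * x k ^ 2) := by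
          -- Subtracting the first order term turns the factor `c` into `c - 1`, which is at most
          -- `q` in absolute value; this is the gain over the bound for `x`.
          have h5 : (lam j - lam k) * (x k - l k) = (c - 1) * a k j +
              inner ℝ ((Dh - D) (u - c • e j)) (e k) - (μ j - lam j) * x k := by
            rw [mul_sub, hcoord k hk, mul_comm _ (l k), hlk k hk]; ring
          rw [hg.weight_sq hk, ← mul_pow, h5]
          refine (sq_add_sub_le _ _ _).trans ?_
          have := hs k
          have := hε k
          rw [hg.weight_sq hk] at this
          rw [mul_pow (c - 1)]
          have : (c - 1) ^ 2 = (1 - c) ^ 2 := by ring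
          rw [this]
          linarith
        have h3 := div_le_div_of_nonneg_right h4 (pow_pos hwk 2).le
        rw [hak k hk, weighted_sum_div_sq hwk,
          mul_div_cancel_left₀ _ (pow_pos hwk 2).ne', ← hρk k hk] at h3
        exact h3
  refine ⟨q, hq0, hq1, hqle, hVle, ?_⟩
  -- the squared norm
  have hEl := (summable_mul_of_sq hVn.summable hls).hasSum
  have hEl2 := hasSum_mul_sq_le hEl hVn.summable hls
  rw [hVn.tsum_eq, ← hL] at hEl2
  have hElabs : |∑' k, (x k - l k) * l k| ≤ ‖V‖ * Real.sqrt L := by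
    refine abs_le_of_sq_le_sq (hEl2.trans_eq ?_) (mul_nonneg (norm_nonneg _) (Real.sqrt_nonneg _))
    rw [mul_pow, Real.sq_sqrt hL0]
  have hqL : q = ‖V‖ ^ 2 + 2 * ∑' k, (x k - l k) * l k + L := by
    refine hxs.unique ?_
    rw [hL]
    exact ((hVn.add (hEl.mul_left 2)).add hls.hasSum).congr_fun fun k => by ring
  -- Combines `2 - 2 * c = (1 - c ^ 2) + (1 - c) ^ 2` with the expansion of the square in `hqL`.
  have hNeq : N = ‖V‖ ^ 2 + 2 * ∑' k, (x k - l k) * l k + (1 - c) ^ 2 := by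
    have h3 : ‖u - e j‖ ^ 2 = 2 - 2 * c := by
      rw [norm_sub_sq_real, real_inner_comm, ← hc, hunorm, hejnorm]; ring
    rw [hN, h3]
    have : q = 1 - c ^ 2 := rfl
    linarith
  rw [hNeq]
  have hE := abs_le.1 hElabs
  rw [abs_le]
  constructor <;> linarith [sq_nonneg ‖V‖, sq_nonneg (1 - c), sq_nonneg q]

end DiagonalPerturbation

end Hilbert

/-! ### Bounds by one weighted sum of squares -/

section Weights

/-- `γ` dominates the weights of all quadratic forms that enter the expansion at index `j`. -/
structure DominatesAt (lam : ℕ → ℝ) (j : ℕ) (g S Λ : ℝ) (γ : ℕ → ℝ) : Prop where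
  S_nonneg : 0 ≤ S
  Lam_nonneg : 0 ≤ Λ
  nonneg : ∀ k, 0 ≤ γ k
  one_le : 1 ≤ γ j
  ratio_le : ∀ k, lam k / relWeight lam j g k ≤ S * γ k
  sq_ratio_le : ∀ k, k ≠ j → lam j * lam k / relWeight lam j g k ^ 2 ≤ Λ * γ k

/-- The terms of the weighted sum of squares `∑ γ_i γ_k y_{i,k}`. -/
def weightedTerm (γ : ℕ → ℝ) (y : ℕ → ℕ → ℝ) (q : ℕ × ℕ) : ℝ := γ q.2 * γ q.1 * y q.2 q.1

variable {lam : ℕ → ℝ} {j : ℕ} {g S Λ κ : ℝ} {γ : ℕ → ℝ} {a y : ℕ → ℕ → ℝ}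

lemma weightedTerm_nonneg (hγ : DominatesAt lam j g S Λ γ) (hy : ∀ i k, 0 ≤ y i k) (q : ℕ × ℕ) :
    0 ≤ weightedTerm γ y q :=
  mul_nonneg (mul_nonneg (hγ.nonneg _) (hγ.nonneg _)) (hy _ _)

/-- Used at `k = j`, where `1 ≤ γ j` lets a single column of `y`, weighted only by `γ i`, be bounded
by the full double sum. -/
lemma tsum_weightedTerm_row_le (hγ : DominatesAt lam j g S Λ γ) (hy : ∀ i k, 0 ≤ y i k)
    (hU : Summable (weightedTerm γ y)) (k : ℕ) :
    ∑' i, weightedTerm γ y (k, i) ≤ ∑' q, weightedTerm γ y q := by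
  rw [hU.tsum_prod]
  exact hU.prod.le_tsum k fun i _ => tsum_nonneg fun l => weightedTerm_nonneg hγ hy _

/-- The entries of `a` are controlled by the weights `λ` and by the numbers `y`, whose weighted sum
is finite. -/
structure EntryBound (lam : ℕ → ℝ) (j : ℕ) (g S Λ κ : ℝ) (γ : ℕ → ℝ) (a y : ℕ → ℕ → ℝ) :
    Prop where
  isGap : IsGap lam j g
  lam_nonneg : ∀ k, 0 ≤ lam k
  dominates : DominatesAt lam j g S Λ γ
  const_nonneg : 0 ≤ κ
  nonneg : ∀ i k, 0 ≤ y i k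
  entry_le : ∀ i k, a i k ^ 2 ≤ κ * (lam i * lam k * y i k)
  summable : Summable (weightedTerm γ y)

namespace EntryBound

lemma relHSTerm_le (h : EntryBound lam j g S Λ κ γ a y) (q : ℕ × ℕ) :
    relHSTerm a (relWeight lam j g) q ≤ κ * S ^ 2 * weightedTerm γ y q := by
  have hw := h.isGap.weight_pos
  have h1 := h.dominates.ratio_le q.1
  have h2 := h.dominates.ratio_le q.2
  have h0 : 0 ≤ lam q.1 / relWeight lam j g q.1 := div_nonneg (h.lam_nonneg _) (hw _).le
  have h3 := mul_le_mul h2 h1 h0 (mul_nonneg h.dominates.S_nonneg (h.dominates.nonneg _))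
  calc relHSTerm a (relWeight lam j g) q
      ≤ κ * (lam q.2 * lam q.1 * y q.2 q.1) / relWeight lam j g q.2 / relWeight lam j g q.1 :=
        div_le_div_of_nonneg_right (div_le_div_of_nonneg_right (h.entry_le _ _) (hw _).le) (hw _).le
    _ = κ * y q.2 q.1 * (lam q.2 / relWeight lam j g q.2 * (lam q.1 / relWeight lam j g q.1)) := by
        field_simp
    _ ≤ κ * y q.2 q.1 * (S * γ q.2 * (S * γ q.1)) :=
        mul_le_mul_of_nonneg_left h3 (mul_nonneg h.const_nonneg (h.nonneg _ _))
    _ = _ := by unfold weightedTerm; ring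

lemma summable_relHSTerm (h : EntryBound lam j g S Λ κ γ a y) : Summable (relHSTerm a (relWeight lam j g)) :=
  Summable.of_nonneg_of_le
    (fun _ => div_nonneg (div_nonneg (sq_nonneg _) (h.isGap.weight_pos _).le) (h.isGap.weight_pos _).le)
    h.relHSTerm_le (h.summable.mul_left _)

lemma tsum_relHSTerm_le (h : EntryBound lam j g S Λ κ γ a y) :
    ∑' q, relHSTerm a (relWeight lam j g) q ≤ κ * S ^ 2 * ∑' q, weightedTerm γ y q := by
  rw [← tsum_mul_left]
  exact h.summable_relHSTerm.tsum_le_tsum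
    h.relHSTerm_le (h.summable.mul_left _)

/-- The factor `λ_j` comes from the fixed index `j` of the entry bound. It cancels against `Λ / λ_j`
in `resolventColumnSq_le`, and only the product of the two is used. -/
lemma columnSq_le (h : EntryBound lam j g S Λ κ γ a y) : columnSq a (relWeight lam j g) j ≤
    κ * lam j * S * ∑' q, weightedTerm γ y q := by
  have hT := h.summable_relHSTerm
  have hw := h.isGap.weight_pos
  have hκl : 0 ≤ κ * lam j := mul_nonneg h.const_nonneg (h.lam_nonneg j)
  refine (Summable.tsum_le_tsum (fun i => ?_) (summable_column hw hT j)
    ((h.summable.prod_factor j).mul_left (κ * lam j * S))).trans ?_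
  · calc a i j ^ 2 / relWeight lam j g i
        ≤ κ * (lam i * lam j * y i j) / relWeight lam j g i :=
          div_le_div_of_nonneg_right (h.entry_le _ _) (hw _).le
      _ = κ * lam j * y i j * (lam i / relWeight lam j g i) := by field_simp
      _ ≤ κ * lam j * y i j * (S * γ i) :=
          mul_le_mul_of_nonneg_left (h.dominates.ratio_le i) (mul_nonneg hκl (h.nonneg _ _))
      _ = κ * lam j * y i j * S * γ i * 1 := by ring
      _ ≤ κ * lam j * y i j * S * γ i * γ j :=
          mul_le_mul_of_nonneg_left h.dominates.one_le
            (mul_nonneg (mul_nonneg (mul_nonneg hκl (h.nonneg _ _)) h.dominates.S_nonneg) (h.dominates.nonneg _))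
      _ = _ := by unfold weightedTerm; ring
  · rw [tsum_mul_left]
    exact mul_le_mul_of_nonneg_left (tsum_weightedTerm_row_le h.dominates h.nonneg h.summable j)
      (mul_nonneg hκl h.dominates.S_nonneg)

lemma resolventColumnSq_le (h : EntryBound lam j g S Λ κ γ a y) : resolventColumnSq a (relWeight lam j g) j ≤
    κ * (Λ / lam j) * S * ∑' q, weightedTerm γ y q := by
  have hT := h.summable_relHSTerm
  have hw := h.isGap.weight_pos
  have hlj : 0 < lam j := h.isGap.pos.trans_le h.isGap.le_lam
  have hc : 0 ≤ κ * (Λ / lam j) * S :=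
    mul_nonneg (mul_nonneg h.const_nonneg (div_nonneg h.dominates.Lam_nonneg hlj.le)) h.dominates.S_nonneg
  rw [h.summable.tsum_prod, ← tsum_mul_left]
  refine Summable.tsum_le_tsum (fun k => ?_) (h.isGap.summable_resolventColumn hT)
    (h.summable.prod.mul_left _)
  split_ifs with hk
  · exact mul_nonneg hc (tsum_nonneg fun i => weightedTerm_nonneg h.dominates h.nonneg _)
  · rw [← tsum_mul_left, columnSq, ← tsum_div_const, ← tsum_div_const]
    refine Summable.tsum_le_tsum (fun i => ?_)
      (((summable_column hw hT k).div_const _).div_const _) ((h.summable.prod_factor k).mul_left _)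
    calc a i k ^ 2 / relWeight lam j g i / relWeight lam j g k / relWeight lam j g k
        ≤ κ * (lam i * lam k * y i k) / relWeight lam j g i / relWeight lam j g k /
            relWeight lam j g k :=
          div_le_div_of_nonneg_right (div_le_div_of_nonneg_right
            (div_le_div_of_nonneg_right (h.entry_le _ _) (hw _).le) (hw _).le) (hw _).le
      _ = κ / lam j * y i k * (lam i / relWeight lam j g i *
            (lam j * lam k / relWeight lam j g k ^ 2)) := by field_simp
      _ ≤ κ / lam j * y i k * (S * γ i * (Λ * γ k)) := by
          refine mul_le_mul_of_nonneg_left (mul_le_mul (h.dominates.ratio_le i) (h.dominates.sq_ratio_le k hk)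
            (div_nonneg (mul_nonneg hlj.le (h.lam_nonneg k)) (sq_nonneg _))
            (mul_nonneg h.dominates.S_nonneg (h.dominates.nonneg _)))
            (mul_nonneg (div_nonneg h.const_nonneg hlj.le) (h.nonneg _ _))
      _ = _ := by unfold weightedTerm; ring

lemma tsum_linCoeff_le (h : EntryBound lam j g S Λ κ γ a y) : ∑' k, linCoeff a lam j k ^ 2 ≤ κ * Λ * ∑' q, weightedTerm γ y q := by
  have hT := h.summable_relHSTerm
  have hc : 0 ≤ κ * Λ := mul_nonneg h.const_nonneg h.dominates.Lam_nonneg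
  refine (Summable.tsum_le_tsum (fun k => ?_) (h.isGap.summable_linCoeff hT)
    ((h.summable.prod_factor j).mul_left (κ * Λ))).trans ?_
  · unfold linCoeff
    split_ifs with hk
    · rw [zero_pow two_ne_zero]
      exact mul_nonneg hc (weightedTerm_nonneg h.dominates h.nonneg _)
    · rw [div_pow, ← h.isGap.weight_sq hk]
      calc a k j ^ 2 / relWeight lam j g k ^ 2
          ≤ κ * (lam k * lam j * y k j) / relWeight lam j g k ^ 2 :=
            div_le_div_of_nonneg_right (h.entry_le _ _) (sq_nonneg _)
        _ = κ * y k j * (lam j * lam k / relWeight lam j g k ^ 2) := by ring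
        _ ≤ κ * y k j * (Λ * γ k) :=
            mul_le_mul_of_nonneg_left (h.dominates.sq_ratio_le k hk) (mul_nonneg h.const_nonneg (h.nonneg _ _))
        _ = κ * y k j * (Λ * γ k) * 1 := by ring
        _ ≤ κ * y k j * (Λ * γ k) * γ j :=
            mul_le_mul_of_nonneg_left h.dominates.one_le (mul_nonneg (mul_nonneg h.const_nonneg (h.nonneg _ _))
              (mul_nonneg h.dominates.Lam_nonneg (h.dominates.nonneg _)))
        _ = _ := by unfold weightedTerm; ring
  · rw [tsum_mul_left]
    exact mul_le_mul_of_nonneg_left (tsum_weightedTerm_row_le h.dominates h.nonneg h.summable j) hc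

end EntryBound

end Weights

/-! ### From the expansion to a single pointwise bound -/

/-- The constant in the pointwise bound of the expansion errors. -/
noncomputable def expansionConst (K : ℝ) (N : ℕ) : ℝ :=
  761 * K ^ 5 + 32 * ((16 * K) ^ (N + 1) * K) + 32 * K ^ 2

section Numeric

variable {K z y U L v n q : ℝ} {N : ℕ}

lemma expansionConst_nonneg (hK : 1 ≤ K) : 0 ≤ expansionConst K N := by
  unfold expansionConst; positivity

/-- The case of a relatively small perturbation. -/
lemma expansion_small (hK : 1 ≤ K) (hz : 0 ≤ z) (hz1 : z ≤ 1) (hy : 0 ≤ y)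
    (hyz : y ≤ K * z ^ 2) (hU : 0 ≤ U) (hL0 : 0 ≤ L) (hL : L ≤ K * (y * U)) {AB T : ℝ}
    (hAB : AB ≤ K ^ 2 * (z ^ 2 * y * U ^ 2)) (hT : T ≤ K * (z ^ 2 * U)) (hq0 : 0 ≤ q)
    (hq1 : q ≤ 1) (hq : q ≤ 4 * (L + 5 * AB))
    (hv : v ^ 2 ≤ 3 * (q ^ 2 * L + 5 * AB + T * q))
    (hn : n ≤ v ^ 2 + 2 * (v * Real.sqrt L) + q ^ 2) :
    v ^ 2 ≤ 159 * K ^ 4 * (z ^ 2 * y * (1 + U) ^ 3) ∧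
      n ≤ 761 * K ^ 5 * (z * y * (1 + U) ^ 4) := by
  have hK0 : 0 ≤ K := by linarith
  set b := 1 + U with hb
  have hb1 : 1 ≤ b := by linarith
  have hb0 : 0 ≤ b := by linarith
  have hUb : U ≤ b := by linarith
  have hzz : z ^ 2 ≤ z := by rw [sq]; exact mul_le_of_le_one_left hz hz1
  have hz2 : z ^ 2 ≤ 1 := hzz.trans hz1
  have hLb : L ≤ K * (y * b) := hL.trans (by gcongr)
  have hABb : AB ≤ K ^ 2 * (z ^ 2 * y * b ^ 2) := hAB.trans (by gcongr)
  have hTb : T ≤ K * (z ^ 2 * b) := hT.trans (by gcongr)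
  -- The constant is `24 = 4 * (1 + 5)`.
  have hqb : q ≤ 24 * K ^ 2 * (y * b ^ 2) := by
    have h1 : K * (y * b) ≤ K ^ 2 * (y * b ^ 2) := by
      have : K ≤ K ^ 2 := le_self_pow₀ hK two_ne_zero
      have : b ≤ b ^ 2 := le_self_pow₀ hb1 two_ne_zero
      gcongr
    have h2 : K ^ 2 * (z ^ 2 * y * b ^ 2) ≤ K ^ 2 * (1 * y * b ^ 2) := by gcongr
    linarith
  have hqq : q ^ 2 ≤ q := by rw [sq]; exact mul_le_of_le_one_left hq0 hq1
  -- A second bound on `q`, trading `y` for `K * z ^ 2`; products such as `q ^ 2` use one bound for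
  -- each factor.
  have hqq' : q ≤ 24 * K ^ 3 * (z ^ 2 * b ^ 2) := hqb.trans <| by
    calc 24 * K ^ 2 * (y * b ^ 2) ≤ 24 * K ^ 2 * (K * z ^ 2 * b ^ 2) := by gcongr
      _ = _ := by ring
  -- Here `159 = 3 * (24 + 5 + 24)`.
  have hv' : v ^ 2 ≤ 159 * K ^ 4 * (z ^ 2 * y * b ^ 3) := by
    have h1 : q ^ 2 * L ≤ 24 * K ^ 3 * (z ^ 2 * b ^ 2) * (K * (y * b)) :=
      mul_le_mul (hqq.trans hqq') hLb hL0 (by positivity)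
    have h2 : T * q ≤ K * (z ^ 2 * b) * (24 * K ^ 2 * (y * b ^ 2)) :=
      mul_le_mul hTb hqb hq0 (by positivity)
    have h3 : K ^ 3 * (z ^ 2 * y * b ^ 3) ≤ K ^ 4 * (z ^ 2 * y * b ^ 3) := by
      gcongr
      norm_num
    have h4 : K ^ 2 * (z ^ 2 * y * b ^ 2) ≤ K ^ 4 * (z ^ 2 * y * b ^ 3) := by
      gcongr <;> norm_num
    linarith
  refine ⟨hv', ?_⟩
  have h1 : v ^ 2 ≤ 159 * (K ^ 5 * (z * y * b ^ 4)) := hv'.trans <| by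
    rw [mul_assoc]
    gcongr <;> norm_num
  have h2 : q ^ 2 ≤ 576 * (K ^ 5 * (z * y * b ^ 4)) := by
    calc q ^ 2 = q * q := sq q
      _ ≤ 24 * K ^ 2 * (y * b ^ 2) * (24 * K ^ 3 * (z ^ 2 * b ^ 2)) :=
        mul_le_mul hqb hqq' hq0 (by positivity)
      _ = 576 * (K ^ 5 * (z ^ 2 * y * b ^ 4)) := by ring
      _ ≤ _ := by gcongr
  -- The constant 13 comes from `159 ≤ 13 ^ 2`; finally `761 = 159 + 2 * 13 + 576`.
  have h3 : v * Real.sqrt L ≤ 13 * (K ^ 5 * (z * y * b ^ 4)) := by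
    have h4 : v * Real.sqrt L ≤ 13 * (K ^ 3 * (z * y * b ^ 2)) := by
      refine le_of_sq_le_sq ?_ (by positivity)
      rw [mul_pow, Real.sq_sqrt hL0]
      calc v ^ 2 * L ≤ 159 * K ^ 4 * (z ^ 2 * y * b ^ 3) * (K * (y * b)) :=
            mul_le_mul hv' hLb hL0 (by positivity)
        _ = 159 * (K ^ 5 * (z ^ 2 * y ^ 2 * b ^ 4)) := by ring
        _ ≤ 169 * (K ^ 6 * (z ^ 2 * y ^ 2 * b ^ 4)) := by
            gcongr <;> norm_num
        _ = _ := by ring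
    refine h4.trans ?_
    gcongr <;> norm_num
  linarith

/-- The case of a perturbation that is not relatively small. -/
lemma expansion_large (hK : 1 ≤ K) (hy : 0 ≤ y)
    (hzN : (z ^ 2) ^ N ≤ K * y) (hU : 0 ≤ U) (hL : L ≤ K * (y * U)) {T : ℝ}
    (hT : T ≤ K * (z ^ 2 * U)) (hlarge : 1 / 16 ≤ T) :
    32 + 2 * L ≤ (32 * ((16 * K) ^ (N + 1) * K) + 32 * K ^ 2) *
      (z ^ 2 * y * (1 + U) ^ (N + 4)) := by
  have hK0 : 0 ≤ K := by linarith
  have h1 : 1 ≤ 16 * K * (z ^ 2 * U) := by linarith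
  have hb1 : 1 ≤ 1 + U := by linarith
  -- Raise `h1` to the power `N + 1`: one factor `z ^ 2` is kept and the other `N` are exchanged for
  -- `K * y`.
  have h2 : 1 ≤ (16 * K) ^ (N + 1) * K * (z ^ 2 * y * (1 + U) ^ (N + 4)) := by
    calc 1 ≤ (16 * K * (z ^ 2 * U)) ^ (N + 1) := one_le_pow₀ h1
      _ = (16 * K) ^ (N + 1) * (z ^ 2 * (z ^ 2) ^ N * U ^ (N + 1)) := by ring
      _ ≤ (16 * K) ^ (N + 1) * (z ^ 2 * (K * y) * (1 + U) ^ (N + 4)) := by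
        gcongr
        calc U ^ (N + 1) ≤ (1 + U) ^ (N + 1) := by gcongr; linarith
          _ ≤ (1 + U) ^ (N + 4) := pow_le_pow_right₀ hb1 (by omega)
      _ = _ := by ring
  have h3 : L ≤ 16 * K ^ 2 * (z ^ 2 * y * (1 + U) ^ (N + 4)) := by
    calc L ≤ K * (y * U) * 1 := by linarith
      _ ≤ K * (y * U) * (16 * K * (z ^ 2 * U)) :=
        mul_le_mul_of_nonneg_left h1 (by positivity)
      _ = 16 * K ^ 2 * (z ^ 2 * y * U ^ 2) := by ring
      _ ≤ _ := by
        gcongr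
        calc U ^ 2 ≤ (1 + U) ^ 2 := by gcongr; linarith
          _ ≤ (1 + U) ^ (N + 4) := pow_le_pow_right₀ hb1 (by omega)
  linarith

end Numeric

section Hilbert

variable {H : Type*} [NormedAddCommGroup H] [InnerProductSpace ℝ H]

namespace DiagonalPerturbation

variable {lam : ℕ → ℝ} {e : ℕ → H} {D Dh : H →L[ℝ] H} {j : ℕ} {g S Λ κ : ℝ} {γ : ℕ → ℝ}
  {y : ℕ → ℕ → ℝ}

/-- Bound of the expansion errors by one power of the weighted sum `∑ γ_i γ_k y_{i,k}`, without
any smallness of the perturbation. -/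
theorem expansion_error_le [CompleteSpace H] (hP : DiagonalPerturbation lam e D Dh)
    (h : EntryBound lam j g S Λ κ γ (matrixEntry (Dh - D) e) y)
    {μ : ℕ → ℝ} {f : ℕ → H} (hf : RankedEigenvectors Dh μ f)
    (hsign : 0 ≤ inner ℝ (f j) (e j)) {K z r n : ℝ} {N : ℕ} {V : H} (hK : 1 ≤ K) (hz : 0 ≤ z)
    (hz1 : z ≤ 1) (hr : 0 ≤ r) (hrz : r ≤ K * z ^ 2) (hzN : (z ^ 2) ^ N ≤ K * r)
    (hS : κ * S ^ 2 ≤ K * z ^ 2) (hΛ : κ * Λ ≤ K * r)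
    (hV : V = f j - e j + (‖f j - e j‖ ^ 2 / 2) • e j -
      ∑' k, linCoeff (matrixEntry (Dh - D) e) lam j k • e k)
    (hn : n = ‖f j - e j‖ ^ 2 - ∑' k, linCoeff (matrixEntry (Dh - D) e) lam j k ^ 2) :
    ‖V‖ ^ 2 ≤ expansionConst K N * (z ^ 2 * r * (1 + ∑' q, weightedTerm γ y q) ^ (N + 4)) ∧
      |n| ≤ expansionConst K N * (z * r * (1 + ∑' q, weightedTerm γ y q) ^ (N + 4)) := by
  set a := matrixEntry (Dh - D) e
  set U := ∑' q, weightedTerm γ y q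
  set T := ∑' q, relHSTerm a (relWeight lam j g) q with hTdef
  set L := ∑' k, linCoeff a lam j k ^ 2 with hLdef
  have hg := h.isGap
  have hU : 0 ≤ U := tsum_nonneg fun q => weightedTerm_nonneg h.dominates h.nonneg q
  have hTs := h.summable_relHSTerm
  have hL0 : 0 ≤ L := tsum_nonneg fun _ => sq_nonneg _
  have hT0 : 0 ≤ T := tsum_nonneg fun _ =>
    div_nonneg (div_nonneg (sq_nonneg _) (hg.weight_pos _).le) (hg.weight_pos _).le
  have hL : L ≤ K * (r * U) := h.tsum_linCoeff_le.trans <| by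
    rw [← mul_assoc]; exact mul_le_mul_of_nonneg_right hΛ hU
  have hT : T ≤ K * (z ^ 2 * U) := h.tsum_relHSTerm_le.trans <| by
    rw [← mul_assoc]; exact mul_le_mul_of_nonneg_right hS hU
  have hb1 : 1 ≤ 1 + U := by linarith
  have hK0 : 0 ≤ K := by linarith
  have hzz : z ^ 2 ≤ z := by rw [sq]; exact mul_le_of_le_one_left hz hz1
  -- The threshold is the square of the bound `1 / 4` on `t` in `eigenvector_expansion`.
  rcases le_or_gt T (1 / 16) with hsmall | hlarge
  · have hlj : 0 < lam j := hg.pos.trans_le hg.le_lam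
    have hAB : resolventColumnSq a (relWeight lam j g) j * columnSq a (relWeight lam j g) j ≤
        K ^ 2 * (z ^ 2 * r * U ^ 2) := by
      have h0 : 0 ≤ κ * (Λ / lam j) * S * U :=
        mul_nonneg (mul_nonneg (mul_nonneg h.const_nonneg
          (div_nonneg h.dominates.Lam_nonneg hlj.le)) h.dominates.S_nonneg) hU
      calc _ ≤ κ * (Λ / lam j) * S * U * (κ * lam j * S * U) :=
            mul_le_mul h.resolventColumnSq_le h.columnSq_le (columnSq_nonneg hg.weight_pos j) h0
        _ = κ * Λ * (κ * S ^ 2) * U ^ 2 := by field_simp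
        _ ≤ K * r * (K * z ^ 2) * U ^ 2 :=
            mul_le_mul_of_nonneg_right (mul_le_mul hΛ hS
              (mul_nonneg h.const_nonneg (sq_nonneg _)) (mul_nonneg hK0 hr)) (sq_nonneg _)
        _ = _ := by ring
    have ht : Real.sqrt T ≤ 1 / 4 := by
      rw [Real.sqrt_le_left (by norm_num)]; norm_num at hsmall ⊢; exact hsmall
    obtain ⟨q, hq0, hq1, hq, hv, hn'⟩ := hP.eigenvector_expansion hg hTs (Real.sqrt_nonneg T) ht
      (Real.sq_sqrt hT0).ge hf hsign hLdef rfl rfl hV hn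
    rw [Real.sq_sqrt hT0] at hv
    obtain ⟨h1, h2⟩ := expansion_small hK hz hz1 hr hrz hU hL0 hL hAB hT hq0 hq1 hq hv hn'
    have h3 : 159 * K ^ 4 ≤ expansionConst K N := by
      have h4 : K ^ 4 ≤ K ^ 5 := pow_le_pow_right₀ hK (by norm_num)
      have h5 : 0 ≤ K ^ 5 := by positivity
      have h6 : 0 ≤ 32 * ((16 * K) ^ (N + 1) * K) + 32 * K ^ 2 := by positivity
      unfold expansionConst
      linarith
    have h3' : 761 * K ^ 5 ≤ expansionConst K N := by
      have h6 : 0 ≤ 32 * ((16 * K) ^ (N + 1) * K) + 32 * K ^ 2 := by positivity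
      unfold expansionConst
      linarith
    constructor
    · refine h1.trans ?_
      gcongr
      · exact expansionConst_nonneg hK
      · omega
    · refine h2.trans ?_
      gcongr
      · exact expansionConst_nonneg hK
      · omega
  · have h1 := expansion_large (N := N) hK hr hzN hU hL hT hlarge.le
    have h2 : 32 * ((16 * K) ^ (N + 1) * K) + 32 * K ^ 2 ≤ expansionConst K N := by
      have : 0 ≤ K ^ 5 := by positivity
      unfold expansionConst
      linarith
    have h3 : 32 + 2 * L ≤
        expansionConst K N * (z ^ 2 * r * (1 + U) ^ (N + 4)) := h1.trans (by gcongr)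
    have hd : ‖f j - e j‖ ≤ 2 := by
      refine (norm_sub_le _ _).trans ?_
      rw [hf.orthonormal.1, hP.e_orthonormal.1]
      norm_num
    have hd2 : ‖f j - e j‖ ^ 2 ≤ 4 := by nlinarith [norm_nonneg (f j - e j)]
    have hlin : ‖∑' k, linCoeff a lam j k • e k‖ ^ 2 = L :=
      (hP.e_orthonormal.hasSum_sq_of_hasSum
        (hP.e_orthonormal.summable_smul_of_sq (hg.summable_linCoeff hTs)).hasSum).tsum_eq.symm
    constructor
    · refine le_trans ?_ h3
      -- `4 = 2 + 2`: a difference of unit vectors and half its square. Squaring gives the 32 in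
      -- `h3`.
      have h4 : ‖V‖ ≤ 4 + ‖∑' k, linCoeff a lam j k • e k‖ := by
        rw [hV]
        refine (norm_sub_le _ _).trans (add_le_add_left ?_ _)
        refine (norm_add_le _ _).trans ?_
        rw [norm_smul, hP.e_orthonormal.1, Real.norm_of_nonneg (by positivity)]
        linarith
      have h5 := pow_le_pow_left₀ (norm_nonneg _) h4 2
      nlinarith [sq_nonneg (4 - ‖∑' k, linCoeff a lam j k • e k‖)]
    · calc |n| ≤ 32 + 2 * L := by
            rw [hn, abs_le]
            constructor <;> nlinarith [sq_nonneg ‖f j - e j‖]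
        _ ≤ _ := h3
        _ ≤ _ := mul_le_mul_of_nonneg_left (by gcongr) (expansionConst_nonneg hK)

end DiagonalPerturbation

/-! ### The empirical model -/

/-- Unconditional summation allows regrouping the double series by its second index, so the matrix
entries are read off and the sum is seen to lie in the closed span of `e`. -/
lemma Orthonormal.hasSum_double {e : ℕ → H} (he : Orthonormal ℝ e) {c : ℕ × ℕ → ℝ} {x : H}
    (hx : HasSum (fun q : ℕ × ℕ => c q • e q.2) x) :
    (∀ k, HasSum (fun i => c (i, k)) (inner ℝ (e k) x)) ∧
      HasSum (fun k => inner ℝ (e k) x • e k) x := by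
  have h1 : ∀ k, HasSum (fun i => c (i, k)) (inner ℝ (e k) x) := fun k => by
    have h := hx.mapL (innerSL ℝ (e k))
    simp only [innerSL_apply_apply, real_inner_smul_right] at h
    have hinj : Function.Injective fun i : ℕ => (i, k) := fun i i' hi => (Prod.ext_iff.1 hi).1
    rw [← hinj.hasSum_iff] at h
    · refine h.congr_fun fun i => ?_
      simp [he.1 k]
    · rintro ⟨i, l⟩ hil
      have : k ≠ l := fun hkl => hil ⟨i, by rw [hkl]⟩
      rw [he.2 this, mul_zero]
  refine ⟨h1, ?_⟩
  have h2 := (Equiv.prodComm ℕ ℕ).hasSum_iff.2 hx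
  exact h2.prod_fiberwise fun k => (h1 k).smul_const (e k)

namespace EmpiricalModel

variable {Ω : Type*} [MeasurableSpace Ω] {P : Measure Ω} (M : EmpiricalModel H P)

/-- The centred component `η^𝓓_{i,k} - E[η^𝓓_{i,k}] - η^𝓡_{i,k}`. -/
noncomputable def noise (i k : ℕ) (ω : Ω) : ℝ :=
  M.etaD i k ω - ∫ ω', M.etaD i k ω' ∂P - M.etaR i k ω

lemma aemeasurable_noise (i k : ℕ) : AEMeasurable (M.noise i k) P :=
  ((M.etaD_measurable i k).sub_const _).sub (M.etaR_measurable i k)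

lemma inner_D_eq (i k : ℕ) : inner ℝ (M.e k) (M.D (M.e i)) =
    Real.sqrt (M.lamT i * M.lamT k) * ∫ ω, M.etaD i k ω ∂P := by
  have h := (M.e_orthonormal.hasSum_double (M.D_expansion (M.e i))).1 k
  refine h.unique ?_
  have h2 := hasSum_single (f := fun l => Real.sqrt (M.lamT l * M.lamT k) *
    (∫ ω, M.etaD l k ω ∂P) * inner ℝ (M.e l) (M.e i)) i fun l hl => by
      rw [M.e_orthonormal.2 hl, mul_zero]
  simpa [M.e_orthonormal.1 i] using h2

/-- Compares the `(j, j)` entry in the two expansions of `𝓓`. With the lower bound on the means this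
lets `λ̃_j` be replaced by a multiple of `λ_j`. -/
lemma lam_eq (j : ℕ) : M.lam j = M.lamT j * ∫ ω, M.etaD j j ω ∂P := by
  have h := M.inner_D_eq j j
  rw [Real.sqrt_mul_self (M.lamT_nonneg j),
    M.e_orthonormal.inner_eq_of_hasSum (M.D_spectral (M.e j)), real_inner_self_eq_norm_sq,
    M.e_orthonormal.1 j] at h
  linarith

lemma lamT_le {C : ℝ} (hC : 0 < C) (h : ∀ j, 1 / C ≤ ∫ ω, M.etaD j j ω ∂P) (j : ℕ) :
    M.lamT j ≤ C * M.lam j := by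
  have h1 := mul_le_mul_of_nonneg_left (h j) (M.lamT_nonneg j)
  rw [← M.lam_eq, mul_one_div, div_le_iff₀ hC] at h1
  linarith

lemma ae_structure : ∀ᵐ ω ∂P,
    DiagonalPerturbation M.lam M.e M.D (M.Dhat ω) ∧
    RankedEigenvectors (M.Dhat ω) (fun j => M.lamHat j ω) (fun j => M.eHat j ω) ∧
    (∀ j, 0 ≤ inner ℝ (M.eHat j ω) (M.e j)) ∧
    ∀ i k, matrixEntry (M.Dhat ω - M.D) M.e i k =
      Real.sqrt (M.lamT i * M.lamT k) * M.noise i k ω := by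
  filter_upwards [M.Dhat_expansion, M.Dhat_symmetric, M.eHat_orthonormal, M.eHat_eigen,
    M.eHat_order, M.eHat_sign] with ω h1 h2 h3 h4 h5 h6
  refine ⟨⟨M.lam_nonneg, M.lam_antitone, M.e_orthonormal, M.D_spectral, h2,
    fun x => (M.e_orthonormal.hasSum_double (h1 x)).2⟩, ⟨h3, h4, h5⟩, h6, fun i k => ?_⟩
  have h := (M.e_orthonormal.hasSum_double (h1 (M.e i))).1 k
  have h7 := hasSum_single (f := fun l => Real.sqrt (M.lamT l * M.lamT k) *
    (M.etaD l k ω - M.etaR l k ω) * inner ℝ (M.e l) (M.e i)) i fun l hl => by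
      rw [M.e_orthonormal.2 hl, mul_zero]
  have h8 := h.unique h7
  simp only [real_inner_self_eq_norm_sq, M.e_orthonormal.1 i] at h8
  unfold matrixEntry
  rw [real_inner_comm, _root_.sub_apply, inner_sub_right, h8, M.inner_D_eq, noise]
  ring

lemma linTerm_eq (j : ℕ) (ω : Ω) (k : ℕ) : M.linTerm j ω k =
    linCoeff (matrixEntry (M.Dhat ω - M.D) M.e) M.lam j k • M.e k := by
  unfold linTerm linCoeff
  split_ifs
  · rw [zero_smul]
  · rfl

lemma sqTerm_eq (j : ℕ) (ω : Ω) (k : ℕ) : M.sqTerm j ω k =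
    linCoeff (matrixEntry (M.Dhat ω - M.D) M.e) M.lam j k ^ 2 := by
  unfold sqTerm linCoeff
  split_ifs
  · rw [zero_pow two_ne_zero]
  · rw [div_pow]; rfl

lemma matrixEntry_sq_le {C m : ℝ} (hC : 0 < C) (hm : 0 < m)
    (h : ∀ j, 1 / C ≤ ∫ ω, M.etaD j j ω ∂P) {ω : Ω} {i k : ℕ}
    (hω : matrixEntry (M.Dhat ω - M.D) M.e i k =
      Real.sqrt (M.lamT i * M.lamT k) * M.noise i k ω) :
    matrixEntry (M.Dhat ω - M.D) M.e i k ^ 2 ≤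
      C ^ 2 / m * (M.lam i * M.lam k * (m * M.noise i k ω ^ 2)) := by
  rw [hω, mul_pow, Real.sq_sqrt (mul_nonneg (M.lamT_nonneg i) (M.lamT_nonneg k))]
  calc M.lamT i * M.lamT k * M.noise i k ω ^ 2
      ≤ C * M.lam i * (C * M.lam k) * M.noise i k ω ^ 2 :=
        mul_le_mul_of_nonneg_right (mul_le_mul (M.lamT_le hC h i) (M.lamT_le hC h k)
          (M.lamT_nonneg k) (mul_nonneg hC.le (M.lam_nonneg i))) (sq_nonneg _)
    _ = _ := by field_simp

end EmpiricalModel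

end Hilbert

/-! ### The weights at an isolated eigenvalue -/

section Gap

/-- The terms of `∑_{i ≠ j} λ_i / |λ_j - λ_i|`. -/
noncomputable def relGapTerm (lam : ℕ → ℝ) (j i : ℕ) : ℝ :=
  if i = j then 0 else lam i / |lam j - lam i|

/-- The terms of `∑_{k ≠ j} λ_j λ_k / (λ_j - λ_k)²`. -/
noncomputable def sqGapTerm (lam : ℕ → ℝ) (j k : ℕ) : ℝ :=
  if k = j then 0 else lam j * lam k / (lam j - lam k) ^ 2

variable {lam : ℕ → ℝ} {j : ℕ}

lemma relGapTerm_nonneg (h0 : ∀ k, 0 ≤ lam k) (i : ℕ) : 0 ≤ relGapTerm lam j i := by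
  unfold relGapTerm
  split_ifs
  exacts [le_rfl, div_nonneg (h0 i) (abs_nonneg _)]

lemma sqGapTerm_nonneg (h0 : ∀ k, 0 ≤ lam k) (k : ℕ) : 0 ≤ sqGapTerm lam j k := by
  unfold sqGapTerm
  split_ifs
  exacts [le_rfl, div_nonneg (mul_nonneg (h0 j) (h0 k)) (sq_nonneg _)]

lemma eventually_half_le_dist (hs : Summable lam) (hj : 0 < lam j) :
    ∀ᶠ i in atTop, lam j / 2 ≤ |lam j - lam i| := by
  filter_upwards [hs.tendsto_atTop_zero.eventually_le_const (half_pos hj)] with i hi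
  exact le_trans (by linarith) (le_abs_self _)

lemma summable_relGapTerm (h0 : ∀ k, 0 ≤ lam k) (hs : Summable lam) (hj : 0 < lam j) :
    Summable (relGapTerm lam j) := by
  refine Summable.of_norm_bounded_eventually_nat (hs.div_const (lam j / 2)) ?_
  filter_upwards [eventually_half_le_dist hs hj] with i hi
  rw [Real.norm_of_nonneg (relGapTerm_nonneg h0 i)]
  unfold relGapTerm
  split_ifs
  · exact div_nonneg (h0 i) (half_pos hj).le
  · exact div_le_div_of_nonneg_left (h0 i) (half_pos hj) hi

lemma summable_sqGapTerm (h0 : ∀ k, 0 ≤ lam k) (hs : Summable lam) (hj : 0 < lam j) :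
    Summable (sqGapTerm lam j) := by
  refine Summable.of_norm_bounded_eventually_nat
    ((hs.mul_left (lam j)).div_const ((lam j / 2) ^ 2)) ?_
  filter_upwards [eventually_half_le_dist hs hj] with i hi
  rw [Real.norm_of_nonneg (sqGapTerm_nonneg h0 i)]
  have h1 : 0 ≤ lam j * lam i := mul_nonneg hj.le (h0 i)
  unfold sqGapTerm
  split_ifs
  · exact div_nonneg h1 (sq_nonneg _)
  · rw [← sq_abs (lam j - lam i)]
    exact div_le_div_of_nonneg_left h1 (pow_pos (half_pos hj) 2)
      (pow_le_pow_left₀ (half_pos hj).le hi 2)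

/-- The gap `λ_j / (1 + ∑_{i ≠ j} λ_i / |λ_j - λ_i|)`. -/
noncomputable def harmonicGap (lam : ℕ → ℝ) (j : ℕ) : ℝ := lam j / (1 + ∑' i, relGapTerm lam j i)

/-- With `G` the sum of the relative gap terms, `λ_i ≤ G * |λ_j - λ_i|`, so `λ_j ≤ |λ_j - λ_i| + λ_i
≤ (1 + G) * |λ_j - λ_i|`. -/
lemma isGap_harmonicGap (h0 : ∀ k, 0 ≤ lam k) (hs : Summable lam) (hj : 0 < lam j)
    (hne : ∀ i, i ≠ j → lam i ≠ lam j) : IsGap lam j (harmonicGap lam j) := by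
  have hG : 0 ≤ ∑' i, relGapTerm lam j i := tsum_nonneg (relGapTerm_nonneg h0)
  refine ⟨div_pos hj (by linarith), div_le_self hj.le (by linarith), fun i hi => ?_⟩
  have hd : 0 < |lam j - lam i| := abs_pos.2 (sub_ne_zero.2 (hne i hi).symm)
  have h1 : lam i / |lam j - lam i| ≤ ∑' i, relGapTerm lam j i := by
    have := (summable_relGapTerm h0 hs hj).le_tsum i fun k _ => relGapTerm_nonneg h0 k
    rwa [relGapTerm, if_neg hi] at this
  rw [div_le_iff₀ hd] at h1
  rw [harmonicGap, div_le_iff₀ (by linarith)]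
  linarith [le_abs_self (lam j - lam i)]

/-- The diagonal ratio `λ_j / g` is exactly one plus the sum of all other ratios; this choice of `g`
therefore costs only a constant factor. -/
lemma hasSum_ratio (h0 : ∀ k, 0 ≤ lam k) (hs : Summable lam) (hj : 0 < lam j) :
    HasSum (fun k => lam k / relWeight lam j (harmonicGap lam j) k)
      (1 + 2 * ∑' i, relGapTerm lam j i) := by
  have hG : 0 ≤ ∑' i, relGapTerm lam j i := tsum_nonneg (relGapTerm_nonneg h0)
  have h1 := (summable_relGapTerm h0 hs hj).hasSum.add
    (hasSum_ite_eq j (1 + ∑' i, relGapTerm lam j i))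
  rw [show (1 : ℝ) + 2 * ∑' i, relGapTerm lam j i =
    ∑' i, relGapTerm lam j i + (1 + ∑' i, relGapTerm lam j i) by ring]
  refine h1.congr_fun fun k => ?_
  unfold relWeight
  by_cases hk : k = j
  · rw [if_pos hk, if_pos hk, relGapTerm, if_pos hk, hk, harmonicGap, zero_add,
      div_div_cancel₀ hj.ne']
  · rw [if_neg hk, if_neg hk, relGapTerm, if_neg hk, add_zero]

/-- A summable sequence that dominates all weights at index `j`. -/
noncomputable def dominatingWeight (lam : ℕ → ℝ) (j k : ℕ) : ℝ :=
  lam k / relWeight lam j (harmonicGap lam j) k / (1 + 2 * ∑' i, relGapTerm lam j i) +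
    (if k = j then 1 else 0) + sqGapTerm lam j k / ∑' k, sqGapTerm lam j k

lemma dominatesAt_dominatingWeight (h0 : ∀ k, 0 ≤ lam k) (hs : Summable lam) (hj : 0 < lam j)
    (hne : ∀ i, i ≠ j → lam i ≠ lam j) (hΛ : 0 < ∑' k, sqGapTerm lam j k) :
    DominatesAt lam j (harmonicGap lam j) (1 + 2 * ∑' i, relGapTerm lam j i)
      (∑' k, sqGapTerm lam j k) (dominatingWeight lam j) := by
  have hg := isGap_harmonicGap h0 hs hj hne
  have hG : 0 ≤ ∑' i, relGapTerm lam j i := tsum_nonneg (relGapTerm_nonneg h0)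
  have hS : 0 < 1 + 2 * ∑' i, relGapTerm lam j i := by linarith
  have ha : ∀ k, 0 ≤ lam k / relWeight lam j (harmonicGap lam j) k /
      (1 + 2 * ∑' i, relGapTerm lam j i) := fun k =>
    div_nonneg (div_nonneg (h0 k) (hg.weight_pos k).le) hS.le
  have hb : ∀ k, (0 : ℝ) ≤ if k = j then 1 else 0 := fun k => by split_ifs <;> norm_num
  have hc : ∀ k, 0 ≤ sqGapTerm lam j k / ∑' k, sqGapTerm lam j k := fun k =>
    div_nonneg (sqGapTerm_nonneg h0 k) hΛ.le
  refine ⟨hS.le, hΛ.le, fun k => add_nonneg (add_nonneg (ha k) (hb k)) (hc k), ?_, fun k => ?_,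
    fun k hk => ?_⟩
  · have h1 := ha j
    have h2 := hc j
    unfold dominatingWeight
    rw [if_pos rfl]
    linarith
  · rw [← div_le_iff₀' hS]
    have h1 := hb k
    have h2 := hc k
    unfold dominatingWeight
    linarith
  · rw [hg.weight_sq hk, ← div_le_iff₀' hΛ]
    have h1 := ha k
    have h2 := hb k
    have h3 : lam j * lam k / (lam j - lam k) ^ 2 = sqGapTerm lam j k := by
      rw [sqGapTerm, if_neg hk]
    rw [h3]
    unfold dominatingWeight
    linarith

/-- Each of the three summands of the weight is normalised to have sum one. -/
lemma hasSum_dominatingWeight (h0 : ∀ k, 0 ≤ lam k) (hs : Summable lam) (hj : 0 < lam j)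
    (hΛ : 0 < ∑' k, sqGapTerm lam j k) : HasSum (dominatingWeight lam j) 3 := by
  have hG : 0 ≤ ∑' i, relGapTerm lam j i := tsum_nonneg (relGapTerm_nonneg h0)
  have h1 := (((hasSum_ratio h0 hs hj).div_const (1 + 2 * ∑' i, relGapTerm lam j i)).add
    (hasSum_ite_eq j (1 : ℝ))).add
    ((summable_sqGapTerm h0 hs hj).hasSum.div_const (∑' k, sqGapTerm lam j k))
  rw [div_self (by linarith), div_self hΛ.ne'] at h1
  norm_num at h1
  exact h1

/-- Keep only the term of the next eigenvalue and use `(λ_j - λ_{j+1}) ^ 2 ≤ λ_j ^ 2`. -/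
lemma le_tsum_sqGapTerm (h0 : ∀ k, 0 ≤ lam k) (hs : Summable lam) (hanti : Antitone lam)
    (hj : 0 < lam j) (hne : lam (j + 1) ≠ lam j) :
    lam (j + 1) / lam j ≤ ∑' k, sqGapTerm lam j k := by
  have h1 := (summable_sqGapTerm h0 hs hj).le_tsum (j + 1) fun k _ => sqGapTerm_nonneg h0 k
  refine le_trans ?_ h1
  rw [sqGapTerm, if_neg (by omega)]
  have h2 : lam (j + 1) < lam j := lt_of_le_of_ne (hanti j.le_succ) hne
  have h3 := h0 (j + 1)
  rw [div_le_div_iff₀ hj (pow_pos (by linarith) 2)]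
  have h4 : (lam j - lam (j + 1)) ^ 2 ≤ lam j ^ 2 := pow_le_pow_left₀ (by linarith) (by linarith) 2
  calc lam (j + 1) * (lam j - lam (j + 1)) ^ 2 ≤ lam (j + 1) * lam j ^ 2 :=
        mul_le_mul_of_nonneg_left h4 h3
    _ = _ := by ring

end Gap

/-! ### Moments of weighted sums -/

section Moments

variable {Ω : Type*} [MeasurableSpace Ω] {P : Measure Ω}

/-- Weighted Hölder inequality. The bound depends on the number of terms only through the total
weight, so it passes to infinite sums. -/
lemma ENNReal.tsum_mul_rpow_le {ι : Type*} (w f : ι → ℝ≥0∞) {r : ℝ} (hr : 1 ≤ r) :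
    (∑' i, w i * f i) ^ r ≤ (∑' i, w i) ^ (r - 1) * ∑' i, w i * f i ^ r := by
  have hr0 : 0 < r := by linarith
  have h1 : ∑' i, w i * f i ≤ (∑' i, w i) ^ (1 - r⁻¹) * (∑' i, w i * f i ^ r) ^ r⁻¹ := by
    rw [ENNReal.tsum_eq_iSup_sum]
    refine iSup_le fun s => (ENNReal.inner_le_weight_mul_Lp_of_nonneg s hr w f).trans ?_
    gcongr
    · exact sub_nonneg.2 (inv_le_one_of_one_le₀ hr)
    · exact ENNReal.sum_le_tsum s
    · exact ENNReal.sum_le_tsum s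
  refine (ENNReal.rpow_le_rpow h1 hr0.le).trans_eq ?_
  rw [ENNReal.mul_rpow_of_nonneg _ _ hr0.le, ← ENNReal.rpow_mul, ← ENNReal.rpow_mul,
    inv_mul_cancel₀ hr0.ne', ENNReal.rpow_one, sub_mul, inv_mul_cancel₀ hr0.ne', one_mul]

lemma lintegral_tsum_mul_rpow_le {ι : Type*} [Countable ι] {w : ι → ℝ≥0∞} {f : ι → Ω → ℝ≥0∞}
    (hf : ∀ i, AEMeasurable (f i) P) {r : ℝ} (hr : 1 ≤ r) {B : ℝ≥0∞}
    (hB : ∀ i, ∫⁻ ω, f i ω ^ r ∂P ≤ B) :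
    ∫⁻ ω, (∑' i, w i * f i ω) ^ r ∂P ≤ (∑' i, w i) ^ (r - 1) * ((∑' i, w i) * B) := by
  have hm : ∀ i, AEMeasurable (fun ω => w i * f i ω ^ r) P := fun i =>
    ((hf i).pow_const r).const_mul _
  calc ∫⁻ ω, (∑' i, w i * f i ω) ^ r ∂P
      ≤ ∫⁻ ω, (∑' i, w i) ^ (r - 1) * ∑' i, w i * f i ω ^ r ∂P :=
        lintegral_mono fun ω => ENNReal.tsum_mul_rpow_le w _ hr
    _ = (∑' i, w i) ^ (r - 1) * ∑' i, w i * ∫⁻ ω, f i ω ^ r ∂P := by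
        rw [lintegral_const_mul'' _ (AEMeasurable.tsum hm), lintegral_tsum hm]
        congr 2
        funext i
        rw [lintegral_const_mul'' _ ((hf i).pow_const r)]
    _ ≤ (∑' i, w i) ^ (r - 1) * ∑' i, w i * B := by
        gcongr
        exact hB _
    _ = _ := by rw [ENNReal.tsum_mul_right]

lemma lintegral_one_add_rpow_le [IsProbabilityMeasure P] (f : Ω → ℝ≥0∞) {r : ℝ} (hr : 1 ≤ r)
    {B : ℝ≥0∞} (hf : AEMeasurable f P) (hB : ∫⁻ ω, f ω ^ r ∂P ≤ B) :
    ∫⁻ ω, (1 + f ω) ^ r ∂P ≤ 2 ^ (r - 1) * (1 + B) := by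
  calc ∫⁻ ω, (1 + f ω) ^ r ∂P ≤ ∫⁻ ω, 2 ^ (r - 1) * (1 ^ r + f ω ^ r) ∂P :=
        lintegral_mono fun ω => ENNReal.rpow_add_le_mul_rpow_add_rpow _ _ hr
    _ = 2 ^ (r - 1) * (1 + ∫⁻ ω, f ω ^ r ∂P) := by
        rw [lintegral_const_mul'' _ ((hf.pow_const r).const_add _),
          lintegral_add_left' aemeasurable_const]
        simp
    _ ≤ _ := by gcongr

lemma lintegral_scaled_sq_rpow_le {f : Ω → ℝ} {m Q : ℝ} (hm : 0 ≤ m) (hQ : 0 < Q) {B : ℝ≥0∞}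
    (hf : AEMeasurable f P)
    (hB : ENNReal.ofReal (Real.sqrt m) * eLpNorm f (ENNReal.ofReal Q) P ≤ B) :
    ∫⁻ ω, ENNReal.ofReal (m * f ω ^ 2) ^ (Q / 2) ∂P ≤ B ^ Q := by
  have h1 : ∀ ω, ENNReal.ofReal (m * f ω ^ 2) ^ (Q / 2) =
      ENNReal.ofReal (Real.sqrt m) ^ Q * ‖f ω‖ₑ ^ Q := fun ω => by
    have h2 : ENNReal.ofReal (m * f ω ^ 2) = (ENNReal.ofReal (Real.sqrt m) * ‖f ω‖ₑ) ^ (2 : ℝ) := by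
      rw [Real.enorm_eq_ofReal_abs, ← ENNReal.ofReal_mul (Real.sqrt_nonneg m),
        ENNReal.ofReal_rpow_of_nonneg (by positivity) (by norm_num), Real.rpow_two, mul_pow,
        Real.sq_sqrt hm, sq_abs]
    rw [h2, ← ENNReal.rpow_mul, mul_div_cancel₀ _ (two_ne_zero),
      ENNReal.mul_rpow_of_nonneg _ _ hQ.le]
  simp_rw [h1]
  rw [lintegral_const_mul'' _ (hf.enorm.pow_const Q)]
  have h3 := ENNReal.rpow_le_rpow hB hQ.le
  rw [ENNReal.mul_rpow_of_nonneg _ _ hQ.le, eLpNorm_eq_lintegral_rpow_enorm_toReal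
    (by simpa using hQ) ENNReal.ofReal_ne_top, ENNReal.toReal_ofReal hQ.le, ← ENNReal.rpow_mul,
    one_div, inv_mul_cancel₀ hQ.ne', ENNReal.rpow_one] at h3
  exact h3

/-- Maximal inequality for finitely many variables with bounded moments. -/
lemma eLpNorm_iSup_le {J : ℕ} (hJ : 1 ≤ J) {f : Fin J → Ω → ℝ} {F : Fin J → Ω → ℝ≥0∞} {p r c : ℝ}
    {R : ℕ} (hp : 1 ≤ p) (hr : R * p ≤ r) (hc : 0 ≤ c) (hF1 : ∀ j ω, 1 ≤ F j ω)
    (hFm : ∀ j, AEMeasurable (F j) P) {G : ℝ} (hG : 0 ≤ G)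
    (hFG : ∀ j, ∫⁻ ω, F j ω ^ r ∂P ≤ ENNReal.ofReal G)
    (hf : ∀ᵐ ω ∂P, ∀ j, ‖f j ω‖ₑ ≤ ENNReal.ofReal c * F j ω ^ R) :
    eLpNorm (fun ω => ⨆ j, f j ω) (ENNReal.ofReal p) P ≤
      ENNReal.ofReal (c * ((J : ℝ) ^ (1 / p) * G ^ (1 / p))) := by
  have hp0 : 0 < p := by linarith
  have : Nonempty (Fin J) := ⟨⟨0, hJ⟩⟩
  rw [eLpNorm_eq_lintegral_rpow_enorm_toReal (by simpa using hp0) ENNReal.ofReal_ne_top,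
    ENNReal.toReal_ofReal hp0.le]
  have h1 : ∫⁻ ω, ‖⨆ j, f j ω‖ₑ ^ p ∂P ≤
      ENNReal.ofReal c ^ p * (J * ENNReal.ofReal G) := by
    calc ∫⁻ ω, ‖⨆ j, f j ω‖ₑ ^ p ∂P
        ≤ ∫⁻ ω, ENNReal.ofReal c ^ p * ∑ j, F j ω ^ r ∂P := by
          refine lintegral_mono_ae ?_
          filter_upwards [hf] with ω hω
          obtain ⟨j, hj⟩ := exists_eq_ciSup_of_finite (f := fun j => f j ω)
          rw [← hj]
          calc ‖f j ω‖ₑ ^ p ≤ (ENNReal.ofReal c * F j ω ^ R) ^ p :=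
                ENNReal.rpow_le_rpow (hω j) hp0.le
            _ = ENNReal.ofReal c ^ p * F j ω ^ (R * p) := by
                rw [ENNReal.mul_rpow_of_nonneg _ _ hp0.le, ← ENNReal.rpow_natCast,
                  ← ENNReal.rpow_mul]
            -- Raising the exponent from `R * p` to `r` is allowed because `F ≥ 1`.
            _ ≤ ENNReal.ofReal c ^ p * F j ω ^ r := by
                gcongr
                exact hF1 j ω
            _ ≤ _ := by
                gcongr
                exact Finset.single_le_sum (f := fun j => F j ω ^ r) (fun _ _ => zero_le)
                  (Finset.mem_univ j)
      _ = ENNReal.ofReal c ^ p * ∑ j, ∫⁻ ω, F j ω ^ r ∂P := by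
          rw [lintegral_const_mul'' _ (Finset.aemeasurable_fun_sum _ fun j _ =>
            (hFm j).pow_const r), lintegral_finsetSum' _ fun j _ => (hFm j).pow_const r]
      _ ≤ ENNReal.ofReal c ^ p * ∑ j : Fin J, ENNReal.ofReal G := by
          gcongr
          exact hFG _
      _ = _ := by simp
  refine (ENNReal.rpow_le_rpow h1 (one_div_nonneg.2 hp0.le)).trans_eq ?_
  rw [ENNReal.mul_rpow_of_nonneg _ _ (one_div_nonneg.2 hp0.le), ← ENNReal.rpow_mul,
    mul_one_div_cancel hp0.ne', ENNReal.rpow_one,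
    ENNReal.mul_rpow_of_nonneg _ _ (one_div_nonneg.2 hp0.le),
    ENNReal.ofReal_rpow_of_nonneg hG (one_div_nonneg.2 hp0.le), ← ENNReal.ofReal_natCast,
    ENNReal.ofReal_rpow_of_nonneg (Nat.cast_nonneg _) (one_div_nonneg.2 hp0.le),
    ENNReal.ofReal_mul hc, ENNReal.ofReal_mul (by positivity)]

end Moments

/-! ### Moments and almost sure bounds for the empirical model -/

namespace EmpiricalModel

variable {H : Type*} [NormedAddCommGroup H] [InnerProductSpace ℝ H]
  {Ω : Type*} [MeasurableSpace Ω] {P : Measure Ω} (M : EmpiricalModel H P)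

/-- One plus the weighted sum of squares of the noise that controls the expansion at index `j`. -/
noncomputable def noiseSum (m : ℝ) (j : ℕ) (ω : Ω) : ℝ≥0∞ :=
  1 + ∑' q : ℕ × ℕ, ENNReal.ofReal (dominatingWeight M.lam j q.2 * dominatingWeight M.lam j q.1) *
    ENNReal.ofReal (m * M.noise q.2 q.1 ω ^ 2)

lemma aemeasurable_noiseTerm (m : ℝ) (i k : ℕ) :
    AEMeasurable (fun ω => ENNReal.ofReal (m * M.noise i k ω ^ 2)) P :=
  (((M.aemeasurable_noise i k).pow_const 2).const_mul m).ennreal_ofReal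

lemma aemeasurable_noiseSum (m : ℝ) (j : ℕ) : AEMeasurable (M.noiseSum m j) P :=
  (AEMeasurable.tsum fun q : ℕ × ℕ =>
    (M.aemeasurable_noiseTerm m q.2 q.1).const_mul _).const_add _

/-- The bound of the moment of order `q / 2` of `noiseSum`. -/
noncomputable def momentConst (B Q : ℝ) : ℝ :=
  (2 ^ (Q / 2 - 1) * (1 + 9 ^ (Q / 2 - 1) * (9 * ENNReal.ofReal B ^ Q)) : ℝ≥0∞).toReal

variable {M} {C s a h p m : ℝ} {Jp : ℕ}

namespace Assumption

lemma lam_pos (hM : M.Assumption C s a h p m Jp) (hC : 0 < C) (hm : 0 < m) {j : ℕ} (hj : j < Jp) :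
    0 < M.lam j :=
  (div_pos (Real.rpow_pos_of_pos hm _) hC).trans_le (hM.lam_lower j hj)

/-- The lower bound uses `λ_{j+1}`, which is where the strict inequality `J < J_m^+` enters. -/
lemma le_Lam (hM : M.Assumption C s a h p m Jp) (hC : 0 < C) (hm : 0 < m) {j : ℕ}
    (hj : j + 1 < Jp) : m ^ (-h) / C ^ 2 ≤ M.Lam j := by
  have hj0 := hM.lam_pos hC hm (j.lt_succ_self.trans hj)
  refine le_trans ?_ (le_tsum_sqGapTerm M.lam_nonneg M.lam_summable M.lam_antitone hj0
    (hM.lam_ne j (j.lt_succ_self.trans hj) (j + 1) (by omega)))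
  have h1 := hM.lam_lower (j + 1) hj
  have h2 : M.lam j ≤ C :=
    (M.lam_summable.le_tsum j fun k _ => M.lam_nonneg k).trans hM.trace_le
  have h3 : 0 ≤ m ^ (-h) := (Real.rpow_pos_of_pos hm _).le
  calc m ^ (-h) / C ^ 2 = m ^ (-h) / C / C := by rw [sq, div_div]
    _ ≤ m ^ (-h) / C / M.lam j :=
      div_le_div_of_nonneg_left (div_nonneg h3 hC.le) hj0 h2
    _ ≤ _ := div_le_div_of_nonneg_right h1 hj0.le

lemma Lam_pos (hM : M.Assumption C s a h p m Jp) (hC : 0 < C) (hm : 0 < m) {j : ℕ}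
    (hj : j + 1 < Jp) : 0 < M.Lam j :=
  (div_pos (Real.rpow_pos_of_pos hm _) (pow_pos hC 2)).trans_le (hM.le_Lam hC hm hj)

lemma one_add_relGapSum_le (hM : M.Assumption C s a h p m Jp) (hC : 0 < C) (hm : 0 < m) {j : ℕ}
    (hj : j + 1 < Jp) : 1 + 2 * M.relGapSum j ≤ 3 * C * m ^ (1 / 2 - a) := by
  have h1 : ∀ i < Jp, M.relGapSum i ≤ C * m ^ (1 / 2 - a) := fun i hi => by
    have := hM.relGapSum_le i hi
    rw [show -(1 / 2 : ℝ) + a = -(1 / 2 - a) by ring, Real.rpow_neg hm.le,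
      inv_mul_le_iff₀ (Real.rpow_pos_of_pos hm _)] at this
    linarith
  -- The term `λ_0 / (λ_0 - λ_1)` alone is at least one, so the bound at index 1 forces `1 ≤ C * m ^
  -- (1 / 2 - a)` and absorbs the summand 1 at every `j`.
  have h2 : 1 ≤ M.relGapSum 1 := by
    have h3 := (summable_relGapTerm M.lam_nonneg M.lam_summable
      (hM.lam_pos hC hm (j := 1) (by omega))).le_tsum 0 fun k _ => relGapTerm_nonneg M.lam_nonneg k
    refine le_trans ?_ h3
    have h4 := hM.lam_ne 1 (by omega) 0 (by omega)
    have h5 : M.lam 1 < M.lam 0 := lt_of_le_of_ne (M.lam_antitone (Nat.zero_le 1)) h4.symm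
    have h6 := M.lam_nonneg 1
    rw [relGapTerm, if_neg (by omega), abs_of_nonpos (by linarith), le_div_iff₀ (by linarith)]
    linarith
  have h3 := h1 j (by omega)
  have h4 := h1 1 (by omega)
  linarith

lemma noise_moment [IsProbabilityMeasure P] (hM : M.Assumption C s a h p m Jp) (hC : 0 ≤ C)
    {S : ℝ} (hS : s ≤ S) (hS0 : 0 ≤ S) (hQ : 1 ≤ momentExponent a h p) (i k : ℕ) :
    ENNReal.ofReal (Real.sqrt m) *
      eLpNorm (M.noise i k) (ENNReal.ofReal (momentExponent a h p)) P ≤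
        ENNReal.ofReal (C + S) := by
  have h1 := eLpNorm_sub_le
    ((M.etaD_measurable i k).sub_const (∫ ω', M.etaD i k ω' ∂P)).aestronglyMeasurable
    (M.etaR_measurable i k).aestronglyMeasurable (p := ENNReal.ofReal (momentExponent a h p))
    (by simpa using hQ)
  refine (mul_le_mul_right h1 _).trans ?_
  rw [mul_add, ENNReal.ofReal_add hC hS0]
  exact add_le_add (hM.etaD_moment i k)
    ((hM.etaR_moment i k).trans (ENNReal.ofReal_le_ofReal hS))

lemma lintegral_noiseSum_le [IsProbabilityMeasure P] (hM : M.Assumption C s a h p m Jp)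
    (hC : 0 < C) (hm : 0 < m) {S : ℝ} (hS : s ≤ S) (hS0 : 0 ≤ S)
    (hQ : 2 ≤ momentExponent a h p) {j : ℕ} (hj : j + 1 < Jp) :
    ∫⁻ ω, M.noiseSum m j ω ^ (momentExponent a h p / 2) ∂P ≤
      ENNReal.ofReal (momentConst (C + S) (momentExponent a h p)) := by
  set Q := momentExponent a h p
  have hj0 := hM.lam_pos hC hm (j.lt_succ_self.trans hj)
  have hΛ : 0 < ∑' k, sqGapTerm M.lam j k := hM.Lam_pos hC hm hj
  have hγ := hasSum_dominatingWeight M.lam_nonneg M.lam_summable hj0 hΛ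
  have hd := dominatesAt_dominatingWeight M.lam_nonneg M.lam_summable hj0
    (hM.lam_ne j (j.lt_succ_self.trans hj)) hΛ
  have hw : ∑' q : ℕ × ℕ, ENNReal.ofReal (dominatingWeight M.lam j q.2 *
      dominatingWeight M.lam j q.1) = 9 := by
    have h1 : ∑' k, ENNReal.ofReal (dominatingWeight M.lam j k) = 3 := by
      rw [← ENNReal.ofReal_tsum_of_nonneg hd.nonneg hγ.summable, hγ.tsum_eq]
      norm_num
    simp_rw [ENNReal.ofReal_mul (hd.nonneg _)]
    rw [ENNReal.tsum_prod (f := fun k i => ENNReal.ofReal (dominatingWeight M.lam j i) *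
      ENNReal.ofReal (dominatingWeight M.lam j k))]
    simp_rw [ENNReal.tsum_mul_right, ENNReal.tsum_mul_left, h1]
    norm_num
  have hr : 1 ≤ Q / 2 := by linarith
  have h1 := lintegral_tsum_mul_rpow_le (P := P)
    (w := fun q : ℕ × ℕ => ENNReal.ofReal (dominatingWeight M.lam j q.2 *
      dominatingWeight M.lam j q.1)) (f := fun q ω => ENNReal.ofReal (m * M.noise q.2 q.1 ω ^ 2))
    (fun q => M.aemeasurable_noiseTerm m q.2 q.1) hr (B := ENNReal.ofReal (C + S) ^ Q)
    fun q => lintegral_scaled_sq_rpow_le hm.le (by linarith) (M.aemeasurable_noise q.2 q.1)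
      (hM.noise_moment hC.le hS hS0 (by linarith) q.2 q.1)
  rw [hw] at h1
  have h2 := lintegral_one_add_rpow_le _ hr (AEMeasurable.tsum fun q : ℕ × ℕ =>
    (M.aemeasurable_noiseTerm m q.2 q.1).const_mul _) h1
  refine h2.trans_eq ?_
  rw [momentConst, ENNReal.ofReal_toReal]
  have hr0 : 0 ≤ Q / 2 - 1 := by linarith
  have h3 : ENNReal.ofReal (C + S) ^ Q ≠ ∞ :=
    ENNReal.rpow_ne_top_of_nonneg (by linarith) ENNReal.ofReal_ne_top
  have h4 : (2 : ℝ≥0∞) ^ (Q / 2 - 1) ≠ ∞ := ENNReal.rpow_ne_top_of_nonneg hr0 (by simp)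
  have h5 : (9 : ℝ≥0∞) ^ (Q / 2 - 1) ≠ ∞ := ENNReal.rpow_ne_top_of_nonneg hr0 (by simp)
  exact ENNReal.mul_ne_top h4 (ENNReal.add_ne_top.2 ⟨ENNReal.one_ne_top,
    ENNReal.mul_ne_top h5 (ENNReal.mul_ne_top (by simp) h3)⟩)

/-- The errors of the expansion at a single index, almost surely. -/
lemma ae_error_le [CompleteSpace H] [IsProbabilityMeasure P] (hM : M.Assumption C s a h p m Jp)
    (hC : 1 ≤ C) (ha : 0 < a) (hh : 1 ≤ h) (hm : 1 ≤ m) {S : ℝ} (hS : s ≤ S) (hS0 : 0 ≤ S)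
    (hQ : 2 ≤ momentExponent a h p) {j : ℕ} (hj : j + 1 < Jp) :
    ∀ᵐ ω ∂P, (Summable (M.linTerm j ω) ∧ Summable (M.sqTerm j ω)) ∧
      ‖‖(1 / Real.sqrt (M.Lam j)) • M.vectorError j ω‖‖ₑ ≤
        ENNReal.ofReal (expansionConst (9 * C ^ 4) ⌈h / a⌉₊ * (m ^ (-a) / Real.sqrt m)) *
          M.noiseSum m j ω ^ (⌈h / a⌉₊ + 4) ∧
      ‖|1 / M.Lam j * M.normError j ω|‖ₑ ≤
        ENNReal.ofReal (expansionConst (9 * C ^ 4) ⌈h / a⌉₊ * (m ^ (-a) / m)) *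
          M.noiseSum m j ω ^ (⌈h / a⌉₊ + 4) := by
  set N := ⌈h / a⌉₊
  set K := 9 * C ^ 4 with hKdef
  set z := m ^ (-a) with hzdef
  have hC0 : 0 < C := by linarith
  have hm0 : 0 < m := by linarith
  have hjp : j < Jp := j.lt_succ_self.trans hj
  have hj0 := hM.lam_pos hC0 hm0 hjp
  have hΛ := hM.Lam_pos hC0 hm0 hj
  have hg := isGap_harmonicGap M.lam_nonneg M.lam_summable hj0 (hM.lam_ne j hjp)
  have hd := dominatesAt_dominatingWeight M.lam_nonneg M.lam_summable hj0 (hM.lam_ne j hjp) hΛ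
  have hC4 : 1 ≤ C ^ 4 := one_le_pow₀ hC
  have hK : 1 ≤ K := by linarith
  have hz : 0 < z := Real.rpow_pos_of_pos hm0 _
  have hz1 : z ≤ 1 := Real.rpow_le_one_of_one_le_of_nonpos hm (by linarith)
  have hz2 : z ^ 2 = m ^ (-(2 * a)) := by
    rw [hzdef, ← Real.rpow_natCast, ← Real.rpow_mul hm0.le]
    congr 1
    push_cast
    ring
  have hr : 0 < M.Lam j / m := div_pos hΛ hm0
  have hCK : C ≤ K := by
    have : C ≤ C ^ 4 := le_self_pow₀ hC (by norm_num)
    linarith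
  have hC2K : C ^ 2 ≤ K := by
    have : C ^ 2 ≤ C ^ 4 := pow_le_pow_right₀ hC (by norm_num)
    linarith
  have hrz : M.Lam j / m ≤ K * z ^ 2 := by
    have h1 := hM.Lam_le j hjp
    have h2 : m ^ (-1 + 2 * a) = (m * z ^ 2)⁻¹ := by
      rw [hz2, Real.rpow_add hm0, Real.rpow_neg_one, Real.rpow_neg hm0.le (2 * a), mul_inv, inv_inv]
    rw [h2, inv_mul_le_iff₀ (by positivity)] at h1
    rw [div_le_iff₀ hm0]
    calc M.Lam j ≤ m * z ^ 2 * C := h1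
      _ ≤ m * z ^ 2 * K := by gcongr
      _ = _ := by ring
  have hzN : (z ^ 2) ^ N ≤ K * (M.Lam j / m) := by
    have h1 : h ≤ a * N := by
      have := Nat.le_ceil (h / a)
      rwa [div_le_iff₀' ha] at this
    calc (z ^ 2) ^ N = m ^ (-(2 * a) * N) := by
          rw [hz2, Real.rpow_mul hm0.le, Real.rpow_natCast]
      -- Here `2 * a * N ≥ 2 * h ≥ h + 1`, by the choice of `N` and `h ≥ 1`.
      _ ≤ m ^ (-h + -1) := Real.rpow_le_rpow_of_exponent_le hm (by linarith)
      _ = m ^ (-h) / m := by rw [Real.rpow_add hm0, Real.rpow_neg_one, div_eq_mul_inv]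
      _ ≤ C ^ 2 * M.Lam j / m := by
          gcongr
          have := hM.le_Lam hC0 hm0 hj
          rwa [div_le_iff₀' (by positivity)] at this
      _ = C ^ 2 * (M.Lam j / m) := by ring
      _ ≤ _ := by gcongr
  have hSK : C ^ 2 / m * (1 + 2 * ∑' i, relGapTerm M.lam j i) ^ 2 ≤ K * z ^ 2 := by
    have h1 : 1 + 2 * ∑' i, relGapTerm M.lam j i ≤ 3 * C * m ^ (1 / 2 - a) :=
      hM.one_add_relGapSum_le hC0 hm0 hj
    have h2 : (m ^ (1 / 2 - a)) ^ 2 = m * z ^ 2 := by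
      rw [hz2, ← Real.rpow_natCast, ← Real.rpow_mul hm0.le]
      nth_rewrite 2 [← Real.rpow_one m]
      rw [← Real.rpow_add hm0]
      congr 1
      push_cast
      ring
    calc C ^ 2 / m * (1 + 2 * ∑' i, relGapTerm M.lam j i) ^ 2
        ≤ C ^ 2 / m * (3 * C * m ^ (1 / 2 - a)) ^ 2 :=
          mul_le_mul_of_nonneg_left (pow_le_pow_left₀ hd.S_nonneg h1 2) (by positivity)
      _ = C ^ 2 / m * (9 * C ^ 2 * (m * z ^ 2)) := by rw [mul_pow, h2]; ring
      _ = _ := by rw [hKdef]; field_simp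
  have hΛK : C ^ 2 / m * ∑' k, sqGapTerm M.lam j k ≤ K * (M.Lam j / m) := by
    calc C ^ 2 / m * ∑' k, sqGapTerm M.lam j k = C ^ 2 * (M.Lam j / m) := by
          rw [show ∑' k, sqGapTerm M.lam j k = M.Lam j from rfl]; ring
      _ ≤ _ := by gcongr
  -- Finiteness of the moment makes the extended sum finite almost surely; all convergence
  -- statements for the series follow from this.
  have hfin : ∀ᵐ ω ∂P, M.noiseSum m j ω < ∞ := by
    have h1 := hM.lintegral_noiseSum_le hC0 hm0 hS hS0 hQ hj
    have h2 := ae_lt_top' ((M.aemeasurable_noiseSum m j).pow_const _)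
      (h1.trans_lt ENNReal.ofReal_lt_top).ne
    filter_upwards [h2] with ω hω
    exact (ENNReal.rpow_lt_top_iff_of_pos (by linarith)).1 hω
  filter_upwards [hfin, M.ae_structure] with ω hω ⟨hP, hf, hsign, hent⟩
  have hy : ∀ i k, 0 ≤ m * M.noise i k ω ^ 2 := fun i k => mul_nonneg hm0.le (sq_nonneg _)
  have hterm : ∀ q : ℕ × ℕ, ENNReal.ofReal (dominatingWeight M.lam j q.2 *
      dominatingWeight M.lam j q.1) * ENNReal.ofReal (m * M.noise q.2 q.1 ω ^ 2) =
      ENNReal.ofReal (weightedTerm (dominatingWeight M.lam j)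
        (fun i k => m * M.noise i k ω ^ 2) q) := fun q =>
    (ENNReal.ofReal_mul (mul_nonneg (hd.nonneg _) (hd.nonneg _))).symm
  have hnn := fun q => weightedTerm_nonneg hd hy q
  have hU : Summable (weightedTerm (dominatingWeight M.lam j)
      (fun i k => m * M.noise i k ω ^ 2)) := by
    have h1 := (ENNReal.add_lt_top.1 hω).2
    simp_rw [hterm] at h1
    exact (ENNReal.summable_toReal h1.ne).congr fun q => ENNReal.toReal_ofReal (hnn q)
  have hb : M.noiseSum m j ω = ENNReal.ofReal (1 + ∑' q, weightedTerm (dominatingWeight M.lam j)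
      (fun i k => m * M.noise i k ω ^ 2) q) := by
    rw [ENNReal.ofReal_add zero_le_one (tsum_nonneg hnn), ENNReal.ofReal_one,
      ENNReal.ofReal_tsum_of_nonneg hnn hU]
    simp_rw [noiseSum, hterm]
  have hE : EntryBound M.lam j (harmonicGap M.lam j) (1 + 2 * ∑' i, relGapTerm M.lam j i)
      (∑' k, sqGapTerm M.lam j k) (C ^ 2 / m) (dominatingWeight M.lam j)
      (matrixEntry (M.Dhat ω - M.D) M.e) (fun i k => m * M.noise i k ω ^ 2) :=
    ⟨hg, M.lam_nonneg, hd, by positivity, hy,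
      fun i k => M.matrixEntry_sq_le hC0 hm0 hM.mean_lower (hent i k), hU⟩
  have hls := hg.summable_linCoeff hE.summable_relHSTerm
  have hlin : M.linTerm j ω = fun k =>
      linCoeff (matrixEntry (M.Dhat ω - M.D) M.e) M.lam j k • M.e k := funext (M.linTerm_eq j ω)
  have hsq : M.sqTerm j ω = fun k =>
      linCoeff (matrixEntry (M.Dhat ω - M.D) M.e) M.lam j k ^ 2 := funext (M.sqTerm_eq j ω)
  have hV : M.vectorError j ω = M.eHat j ω - M.e j + (‖M.eHat j ω - M.e j‖ ^ 2 / 2) • M.e j -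
      ∑' k, linCoeff (matrixEntry (M.Dhat ω - M.D) M.e) M.lam j k • M.e k := by
    rw [vectorError, hlin]
  have hn : M.normError j ω = ‖M.eHat j ω - M.e j‖ ^ 2 -
      ∑' k, linCoeff (matrixEntry (M.Dhat ω - M.D) M.e) M.lam j k ^ 2 := by
    rw [normError, hsq]
  obtain ⟨h1, h2⟩ := hP.expansion_error_le hE hf (hsign j) hK hz.le hz1 hr.le hrz hzN hSK hΛK hV hn
  set b := 1 + ∑' q, weightedTerm (dominatingWeight M.lam j) (fun i k => m * M.noise i k ω ^ 2) q
  have hb1 : 1 ≤ b := le_add_of_nonneg_right (tsum_nonneg hnn)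
  have hb0 : 0 ≤ b := by linarith
  set E := expansionConst K N with hEdef
  have hE1 : 1 ≤ E := by
    have h3 : 1 ≤ K ^ 5 := one_le_pow₀ hK
    have h4 : 0 ≤ 32 * ((16 * K) ^ (N + 1) * K) + 32 * K ^ 2 := by positivity
    rw [hEdef, expansionConst]
    linarith
  refine ⟨⟨hlin ▸ hP.e_orthonormal.summable_smul_of_sq hls, hsq ▸ hls⟩, ?_, ?_⟩
  · rw [hb, ← ENNReal.ofReal_pow hb0, ← ENNReal.ofReal_mul (by positivity),
      Real.enorm_of_nonneg (norm_nonneg _)]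
    refine ENNReal.ofReal_le_ofReal ?_
    rw [norm_smul, Real.norm_of_nonneg (by positivity)]
    refine le_of_sq_le_sq ?_ (by positivity)
    rw [mul_pow, div_pow, one_pow, Real.sq_sqrt hΛ.le, mul_pow, mul_pow, div_pow,
      Real.sq_sqrt hm0.le]
    calc 1 / M.Lam j * ‖M.vectorError j ω‖ ^ 2
        ≤ 1 / M.Lam j * (E * (z ^ 2 * (M.Lam j / m) * b ^ (N + 4))) := by gcongr
      _ = E * (z ^ 2 / m) * b ^ (N + 4) := by field_simp
      -- The square root of the power of `b` is not exploited, so that both errors get the same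
      -- constant and the same power.
      _ ≤ E ^ 2 * (z ^ 2 / m) * (b ^ (N + 4)) ^ 2 := by
          gcongr
          · exact le_self_pow₀ hE1 two_ne_zero
          · exact le_self_pow₀ (one_le_pow₀ hb1) two_ne_zero
  · rw [hb, ← ENNReal.ofReal_pow hb0, ← ENNReal.ofReal_mul (by positivity),
      Real.enorm_of_nonneg (abs_nonneg _)]
    refine ENNReal.ofReal_le_ofReal ?_
    rw [abs_mul, abs_of_nonneg (by positivity)]
    calc 1 / M.Lam j * |M.normError j ω|
        ≤ 1 / M.Lam j * (E * (z * (M.Lam j / m) * b ^ (N + 4))) := by gcongr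
      _ = E * (z / m) * b ^ (N + 4) := by field_simp

/-- The expansions for a size parameter `m ≥ 1`. -/
lemma expansion_of_one_le [CompleteSpace H] [IsProbabilityMeasure P]
    (hM : M.Assumption C s a h p m Jp) (hC : 1 ≤ C) (ha : 0 < a) (hh : 1 ≤ h) (hp : 1 ≤ p)
    (hm : 1 ≤ m) {S : ℝ} (hS : s ≤ S) (hS0 : 0 ≤ S) {J : ℕ} (hJ : 1 ≤ J) (hJp : J < Jp) :
    (∀ᵐ ω ∂P, ∀ j < J, Summable (M.linTerm j ω) ∧ Summable (M.sqTerm j ω)) ∧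
    eLpNorm (fun ω => ⨆ j : Fin J, ‖(1 / Real.sqrt (M.Lam j)) • M.vectorError j ω‖)
        (ENNReal.ofReal p) P
      ≤ ENNReal.ofReal (expansionConst (9 * C ^ 4) ⌈h / a⌉₊ * (m ^ (-a) / Real.sqrt m) *
        ((J : ℝ) ^ (1 / p) * momentConst (C + S) (momentExponent a h p) ^ (1 / p))) ∧
    eLpNorm (fun ω => ⨆ j : Fin J, |1 / M.Lam j * M.normError j ω|)
        (ENNReal.ofReal p) P
      ≤ ENNReal.ofReal (expansionConst (9 * C ^ 4) ⌈h / a⌉₊ * (m ^ (-a) / m) *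
        ((J : ℝ) ^ (1 / p) * momentConst (C + S) (momentExponent a h p) ^ (1 / p))) := by
  have hC0 : 0 < C := by linarith
  have hm0 : 0 < m := by linarith
  have hR : ((⌈h / a⌉₊ + 4 : ℕ) : ℝ) * p ≤ momentExponent a h p / 2 := by
    -- Only half of `q` is available, as `noiseSum` is quadratic in the noise; `N + 4 ≤ 2 ^ (N + 3)`
    -- is enough for the power `N + 4`.
    have h1 : ((⌈h / a⌉₊ + 4 : ℕ) : ℝ) ≤ 2 ^ (⌈h / a⌉₊ + 3) := by
      exact_mod_cast (show ⌈h / a⌉₊ + 3 < 2 ^ (⌈h / a⌉₊ + 3) from Nat.lt_two_pow_self)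
    rw [momentExponent, pow_succ]
    nlinarith
  have hQ : 2 ≤ momentExponent a h p := by
    have h1 : (1 : ℝ) * 1 ≤ ((⌈h / a⌉₊ + 4 : ℕ) : ℝ) * p :=
      mul_le_mul (by norm_cast; omega) hp zero_le_one (Nat.cast_nonneg _)
    linarith
  have hae : ∀ j : Fin J, _ := fun j =>
    hM.ae_error_le hC ha hh hm hS hS0 hQ (j := j) (by have := j.2; omega)
  have hae' := ae_all_iff.2 hae
  have hE := expansionConst_nonneg (N := ⌈h / a⌉₊) (show 1 ≤ 9 * C ^ 4 by
    have : 1 ≤ C ^ 4 := one_le_pow₀ hC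
    linarith)
  have hG : 0 ≤ momentConst (C + S) (momentExponent a h p) := ENNReal.toReal_nonneg
  have hF1 : ∀ (j : Fin J) (ω : Ω), 1 ≤ M.noiseSum m j ω := fun j ω => le_self_add
  have hmom : ∀ j : Fin J, _ := fun j =>
    hM.lintegral_noiseSum_le hC0 hm0 hS hS0 hQ (j := j) (by have := j.2; omega)
  refine ⟨?_, ?_, ?_⟩
  · filter_upwards [hae'] with ω hω j hj
    exact (hω ⟨j, hj⟩).1
  · refine eLpNorm_iSup_le hJ hp hR (by positivity) hF1
      (fun j => M.aemeasurable_noiseSum m j) hG hmom ?_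
    filter_upwards [hae'] with ω hω j
    exact (hω j).2.1
  · refine eLpNorm_iSup_le hJ hp hR (by positivity) hF1
      (fun j => M.aemeasurable_noiseSum m j) hG hmom ?_
    filter_upwards [hae'] with ω hω j
    exact (hω j).2.2

/-! ### Reduction to size parameters at least one -/

/-- The constant after dividing the size parameter by `m₀`. -/
noncomputable def rescaledConst (C a m₀ : ℝ) : ℝ :=
  1 + C + C / Real.sqrt m₀ + C * m₀ ^ (1 / 2 - a) + C * m₀ ^ (1 - 2 * a)

/-- The assumptions are stable under division of the size parameter by `m₀ ≤ 1`. -/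
lemma rescale (hM : M.Assumption C s a h p m Jp) (hC : 0 < C) (hh : 0 ≤ h) (hm : 0 < m) {m₀ : ℝ}
    (hm₀ : 0 < m₀) (hm₁ : m₀ ≤ 1) :
    M.Assumption (rescaledConst C a m₀) (s / Real.sqrt m₀) a h p (m / m₀) Jp := by
  have hs0 : 0 < Real.sqrt m₀ := Real.sqrt_pos.2 hm₀
  have h1 : 0 ≤ C / Real.sqrt m₀ := by positivity
  have h2 : 0 ≤ C * m₀ ^ (1 / 2 - a) := by positivity
  have h3 : 0 ≤ C * m₀ ^ (1 - 2 * a) := by positivity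
  have hCC : C ≤ rescaledConst C a m₀ := by unfold rescaledConst; linarith
  have hmom : ∀ {X : ℝ≥0∞} {c : ℝ}, ENNReal.ofReal (Real.sqrt m) * X ≤ ENNReal.ofReal c →
      ENNReal.ofReal (Real.sqrt (m / m₀)) * X ≤ ENNReal.ofReal (c / Real.sqrt m₀) := by
    intro X c hX
    rw [Real.sqrt_div hm.le, div_eq_mul_inv, div_eq_mul_inv c, mul_comm, mul_comm c,
      ENNReal.ofReal_mul (inv_nonneg.2 hs0.le), mul_comm X, mul_comm (Real.sqrt m),
      ENNReal.ofReal_mul (inv_nonneg.2 hs0.le), mul_assoc]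
    exact mul_le_mul_right hX _
  have hpow : ∀ (x : ℝ), (m / m₀) ^ x = m ^ x * m₀ ^ (-x) := fun x => by
    rw [Real.div_rpow hm.le hm₀.le, Real.rpow_neg hm₀.le, div_eq_mul_inv]
  refine ⟨fun i k => ?_, fun i k => hmom (hM.etaR_moment i k), hM.lam_ne, fun j hj => ?_,
    fun j hj => ?_, fun j hj => ?_, fun j => ?_, fun j => (hM.mean_upper j).trans hCC,
    hM.trace_le.trans hCC⟩
  · refine (hmom (hM.etaD_moment i k)).trans (ENNReal.ofReal_le_ofReal ?_)
    unfold rescaledConst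
    linarith
  · have h4 := mul_le_mul_of_nonneg_right (hM.relGapSum_le j hj)
      (Real.rpow_nonneg hm₀.le (1 / 2 - a))
    rw [hpow, show -(-(1 / 2) + a) = 1 / 2 - a by ring]
    unfold rescaledConst
    linarith
  · have h4 := mul_le_mul_of_nonneg_right (hM.Lam_le j hj) (Real.rpow_nonneg hm₀.le (1 - 2 * a))
    rw [hpow, show -(-1 + 2 * a) = 1 - 2 * a by ring]
    unfold rescaledConst
    linarith
  · refine le_trans ?_ (hM.lam_lower j hj)
    rw [hpow, neg_neg]
    have h4 : m₀ ^ h ≤ 1 := Real.rpow_le_one hm₀.le hm₁ hh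
    exact div_le_div₀ (by positivity) (mul_le_of_le_one_right (by positivity) h4) hC hCC
  · exact (one_div_le_one_div_of_le hC hCC).trans (hM.mean_lower j)

end Assumption

end EmpiricalModel

theorem mainTheorem2 (C a h p : ℝ) (hC : 0 < C) (ha : 0 < a) (hh : 1 ≤ h) (hp : 1 ≤ p)
    (m s : ℕ → ℝ) (hm_pos : ∀ n, 0 < m n) (hm : Tendsto m atTop atTop)
    (hs : Tendsto s atTop (𝓝 0)) :
    ∃ K : ℝ, ∀ (n : ℕ) (d : ℕ) (T : Set (EuclideanSpace ℝ (Fin d))), IsCompact T →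
      ∀ (Ω : Type*) [MeasurableSpace Ω] (P : Measure Ω) [IsProbabilityMeasure P]
        (M : EmpiricalModel (L2 T) P) (Jp : ℕ), M.Assumption C (s n) a h p (m n) Jp →
      ∀ J : ℕ, 1 ≤ J → J < Jp →
        (∀ᵐ ω ∂P, ∀ j < J, Summable (M.linTerm j ω) ∧ Summable (M.sqTerm j ω)) ∧
        eLpNorm (fun ω => ⨆ j : Fin J, ‖(1 / Real.sqrt (M.Lam j)) • M.vectorError j ω‖)
            (ENNReal.ofReal p) P
          ≤ ENNReal.ofReal (K * ((J : ℝ) ^ (1 / p) * m n ^ (-a) / Real.sqrt (m n))) ∧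
        eLpNorm (fun ω => ⨆ j : Fin J, |1 / M.Lam j * M.normError j ω|)
            (ENNReal.ofReal p) P
          ≤ ENNReal.ofReal (K * ((J : ℝ) ^ (1 / p) * m n ^ (-a) / m n)) := by
  obtain ⟨S, hS⟩ := hs.bddAbove_range
  have hS' : ∀ n, s n ≤ |S| := fun n => (hS ⟨n, rfl⟩).trans (le_abs_self S)
  -- A positive sequence tending to infinity is bounded below by a positive number: beyond some
  -- index it is at least one, and finitely many terms remain.
  obtain ⟨m₀, hm₀, hm₁, hmm⟩ : ∃ m₀ : ℝ, 0 < m₀ ∧ m₀ ≤ 1 ∧ ∀ n, m₀ ≤ m n := by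
    obtain ⟨n₀, hn₀⟩ := (hm.eventually_ge_atTop 1).exists_forall_of_atTop
    obtain ⟨i, -, hi⟩ := (Finset.range (n₀ + 1)).exists_min_image m ⟨0, by simp⟩
    refine ⟨min 1 (m i), lt_min one_pos (hm_pos i), min_le_left _ _, fun n => ?_⟩
    rcases le_or_gt n₀ n with hn | hn
    · exact (min_le_left _ _).trans (hn₀ n hn)
    · exact (min_le_right _ _).trans (hi n (Finset.mem_range.2 (by omega)))
  set C' := EmpiricalModel.Assumption.rescaledConst C a m₀ with hC'
  have hs0 : 0 < Real.sqrt m₀ := Real.sqrt_pos.2 hm₀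
  have hC1 : 1 ≤ C' := by
    have h1 : 0 ≤ C / Real.sqrt m₀ := by positivity
    have h2 : 0 ≤ C * m₀ ^ (1 / 2 - a) := by positivity
    have h3 : 0 ≤ C * m₀ ^ (1 - 2 * a) := by positivity
    rw [hC', EmpiricalModel.Assumption.rescaledConst]
    linarith
  set E := expansionConst (9 * C' ^ 4) ⌈h / a⌉₊
  have hE : 0 ≤ E := expansionConst_nonneg (by
    have : 1 ≤ C' ^ 4 := one_le_pow₀ hC1
    linarith)
  set G := EmpiricalModel.momentConst (C' + |S| / Real.sqrt m₀)
    (EmpiricalModel.momentExponent a h p) ^ (1 / p)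
  have hG : 0 ≤ G := Real.rpow_nonneg ENNReal.toReal_nonneg _
  -- Undoing the rescaling costs `m₀ ^ a * √m₀` in the first bound and `m₀ ^ a * m₀` in the second;
  -- the sum covers both.
  refine ⟨E * G * (m₀ ^ a * (Real.sqrt m₀ + m₀)), ?_⟩
  intro n d T _ Ω _ P _ M Jp hM J hJ hJp
  have hmn := hm_pos n
  have hM' := hM.rescale hC (by linarith) hmn hm₀ hm₁
  obtain ⟨h1, h2, h3⟩ := hM'.expansion_of_one_le hC1 ha hh hp
    ((one_le_div hm₀).2 (hmm n)) (div_le_div_of_nonneg_right (hS' n) hs0.le)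
    (by positivity) hJ hJp
  have hpow : (m n / m₀) ^ (-a) = m n ^ (-a) * m₀ ^ a := by
    rw [Real.div_rpow hmn.le hm₀.le, Real.rpow_neg hm₀.le, div_inv_eq_mul]
  have hsn : 0 < Real.sqrt (m n) := Real.sqrt_pos.2 hmn
  have hbase : 0 ≤ E * G * ((J : ℝ) ^ (1 / p) * m n ^ (-a)) * m₀ ^ a := by positivity
  refine ⟨h1, h2.trans (ENNReal.ofReal_le_ofReal ?_), h3.trans (ENNReal.ofReal_le_ofReal ?_)⟩
  · rw [hpow, Real.sqrt_div hmn.le]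
    calc E * (m n ^ (-a) * m₀ ^ a / (Real.sqrt (m n) / Real.sqrt m₀)) * ((J : ℝ) ^ (1 / p) * G)
        = E * G * ((J : ℝ) ^ (1 / p) * m n ^ (-a)) * m₀ ^ a * (Real.sqrt m₀ / Real.sqrt (m n)) := by
          field_simp
      _ ≤ E * G * ((J : ℝ) ^ (1 / p) * m n ^ (-a)) * m₀ ^ a *
          ((Real.sqrt m₀ + m₀) / Real.sqrt (m n)) := by
          gcongr
          linarith
      _ = _ := by ring
  · rw [hpow]
    calc E * (m n ^ (-a) * m₀ ^ a / (m n / m₀)) * ((J : ℝ) ^ (1 / p) * G)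
        = E * G * ((J : ℝ) ^ (1 / p) * m n ^ (-a)) * m₀ ^ a * (m₀ / m n) := by
          field_simp
      _ ≤ E * G * ((J : ℝ) ^ (1 / p) * m n ^ (-a)) * m₀ ^ a *
          ((Real.sqrt m₀ + m₀) / m n) := by
          gcongr
          linarith
      _ = _ := by ring
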